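/- **Corollary 2.5.** Let $q_0,q_1,q_2$ be the vertices of an equilateral triangle in the plane, $F_jx=(x+q_j)/2$, and let $\mathcal{SG}$ be the Sierpinski gasket, the unique nonempty compact set with $\mathcal{SG}=\bigcup_{j=0}^2F_j\mathcal{SG}$. Put $V_0=\{q_0,q_1,q_2\}$. A *cell* is a set $F_w(\mathcal{SG})$, where $F_w$ is a finite composition of the $F_j$. A function on a cell is *given by harmonic extension* of its values at the three boundary points $F_wq_i$ of the cell if it is continuous there and, on each subcell with vertices $v_0,v_1,v_2$, its value at the midpoint of $v_i$ and $v_j$ is $\frac{2u(v_i)+2u(v_j)+u(v_k)}{5}$ for $\{i,j,k\}=\{0,1,2\}$. Let $h_s$ be the function on $\mathcal{SG}$ given by harmonic extension of $(h_s(q_0),h_s(q_1),h_s(q_2))=(0,1,-1)$, and let $$\Omega=\{x\in\mathcal{SG}\setminus V_0: h_s(x)>0\},\quad X=\{x\in\mathcal{SG}\setminus V_0:h_s(x)=0\},\quad \partial\Omega=\{q_0,q_1\}\cup X,\quad \overline\Omega=\Omega\cup\partial\Omega .$$ Let $x_m=F_0^{m-1}F_2q_1$ $(m\ge1)$ and $y_m=F_0^mq_1$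 $(m\ge 0)$, so $y_0=q_1$. Then $X=\{x_m\}_{m\ge1}$, and $\overline\Omega$ is the union of $\{q_0\}$ and the cells $F_0^{m-1}F_1(\mathcal{SG})$, $m\ge1$, with boundary points $x_m,y_{m-1},y_m$. Let $\mathcal E(u,v)=\lim_{m}\mathcal E_m(u,v)$ with $\mathcal E_m(u,v)=\left(\tfrac53\right)^m\sum_{x\sim_m y}(u(x)-u(y))(v(x)-v(y))$, the sum being over the edges $\{x,y\}$ of the cells of level $m$. We say that $\triangle u=0$ on $\Omega$ if $u$ is continuous on $\Omega$, has finite energy on each cell contained in $\Omega$, and $\mathcal E(u,v)=0$ for every continuous $v$ of finite energy on $\mathcal{SG}$ that vanishes outside a compact subset of $\Omega$. Given real numbers $a_0,a_1,a_2,\dots$, the BVP is $$\triangle u=0\ \text{ on }\Omega,\qquad u(q_1)=a_0,\qquad u(x_m)=a_m\quad(m\ge1).$$ Suppose $a_m\to A$ as $m\to\infty$ for some constant $A\in\mathbb R$. Then the series below converge, and there is a function $u$ on $\overline\Omega$ which on each cell $F_0^{m-1}F_1(\mathcal{SG})$, $m\ge1$, is given by harmonic extension of the values $u(q_1)=a_0$,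 $u(x_m)=a_m$, $$u(y_1)=\frac15\Big(a_0+a_1+18\sum_{k=2}^\infty\frac{1}{3^k}a_k\Big),$$ and, for $m\ge2$, $$u(y_m)=\frac1{5^m}\Big(a_0-\frac97\sum_{k=1}^\infty\frac1{3^k}a_k+\frac27\sum_{k=1}^m5^ka_k\Big)+\frac97\sum_{k=1}^\infty\frac1{3^k}a_{m+k},$$ and which satisfies $u(q_0)=A$. Any such function $u$ is continuous on $\overline\Omega$ and solves the BVP, and it is the unique solution of the BVP in $C(\overline\Omega)$. -/

import Mathlib

open Set Filter Topology MeasureTheory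

noncomputable section

namespace HalfGasket

/-- The Euclidean plane. -/
abbrev Plane : Type := EuclideanSpace ℝ (Fin 2)

/-! ### The Sierpinski gasket -/

/-- The contraction `F_j x = (x + q_j) / 2`. -/
def F (q : Fin 3 → Plane) (j : Fin 3) (x : Plane) : Plane := (1 / 2 : ℝ) • (x + q j)

/-- `F_w = F_{w_1} ∘ ⋯ ∘ F_{w_n}` for a word `w = w_1 ⋯ w_n`. -/
def cellMap (q : Fin 3 → Plane) : List (Fin 3) → Plane → Plane
  | [], x => x
  | i :: w, x => F q i (cellMap q w x)

/-- The point `lim_n F_{ω_0} ∘ ⋯ ∘ F_{ω_n} (x)` (independent of `x`) with the infinite address `ω`. -/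
def address (q : Fin 3 → Plane) (ω : ℕ → Fin 3) : Plane :=
  ∑' k : ℕ, (1 / 2 : ℝ) ^ (k + 1) • q (ω k)

/-- The Sierpinski gasket with vertices `q_0, q_1, q_2`; `existsUnique_gasket` below says that it is
the unique nonempty compact set `K` with `K = ⋃ j, F_j K`. -/
def gasket (q : Fin 3 → Plane) : Set Plane := range (address q)

lemma summable_address (q : Fin 3 → Plane) (ω : ℕ → Fin 3) :
    Summable fun k : ℕ => (1 / 2 : ℝ) ^ (k + 1) • q (ω k) := by
  refine Summable.of_norm_bounded (g := fun k : ℕ => (1 / 2 : ℝ) ^ (k + 1) * ∑ i, ‖q i‖) ?_ ?_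
  · exact ((summable_nat_add_iff 1).2 summable_geometric_two).mul_right _
  · intro k
    rw [norm_smul, Real.norm_of_nonneg (by positivity)]
    gcongr
    exact Finset.single_le_sum (f := fun i => ‖q i‖) (fun i _ => norm_nonneg _) (Finset.mem_univ _)

lemma continuous_address (q : Fin 3 → Plane) : Continuous (address q) := by
  refine continuous_tsum (u := fun k : ℕ => (1 / 2 : ℝ) ^ (k + 1) * ∑ i, ‖q i‖) ?_ ?_ ?_
  · intro k
    have h : Continuous q := continuous_of_discreteTopology
    have h' : Continuous fun ω : ℕ → Fin 3 => ω k := continuous_apply k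
    exact (h.comp h').const_smul ((1 / 2 : ℝ) ^ (k + 1))
  · exact ((summable_nat_add_iff 1).2 summable_geometric_two).mul_right _
  · intro k ω
    rw [norm_smul, Real.norm_of_nonneg (by positivity)]
    gcongr
    exact Finset.single_le_sum (f := fun i => ‖q i‖) (fun i _ => norm_nonneg _) (Finset.mem_univ _)

lemma address_eq (q : Fin 3 → Plane) (ω : ℕ → Fin 3) :
    address q ω = F q (ω 0) (address q fun k => ω (k + 1)) := by
  have h := (summable_address q ω).tsum_eq_zero_add
  unfold address F
  rw [h, smul_add, ← tsum_const_smul'' (1 / 2 : ℝ), add_comm]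
  congr 1
  · congr 1; funext k; rw [smul_smul]; congr 1; ring
  · simp

lemma isCompact_gasket (q : Fin 3 → Plane) : IsCompact (gasket q) :=
  isCompact_range (continuous_address q)

lemma gasket_eq (q : Fin 3 → Plane) : gasket q = ⋃ j, F q j '' gasket q := by
  ext x
  simp only [mem_iUnion, mem_image, gasket, mem_range]
  constructor
  · rintro ⟨ω, rfl⟩
    exact ⟨ω 0, _, ⟨_, rfl⟩, (address_eq q ω).symm⟩
  · rintro ⟨j, _, ⟨ω, rfl⟩, rfl⟩
    exact ⟨fun k => Nat.casesOn k j ω, address_eq q _⟩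

lemma dist_F (q : Fin 3 → Plane) (j : Fin 3) (x y : Plane) :
    dist (F q j x) (F q j y) = 1 / 2 * dist x y := by
  rw [F, F, dist_smul₀, dist_add_right, Real.norm_of_nonneg (by norm_num)]

lemma subset_of_selfSimilar (q : Fin 3 → Plane) {K L : Set Plane} (hK : IsCompact K)
    (hKs : K = ⋃ j, F q j '' K) (hL : IsCompact L) (hL0 : L.Nonempty)
    (hLs : L = ⋃ j, F q j '' L) : K ⊆ L := by
  obtain ⟨C, hC⟩ := hK.bddAbove_image (f := fun x => Metric.infDist x L)
    (Metric.continuous_infDist_pt L).continuousOn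
  have key : ∀ n : ℕ, ∀ x ∈ K, Metric.infDist x L ≤ (1 / 2 : ℝ) ^ n * C := by
    intro n
    induction n with
    | zero => intro x hx; simpa using hC (mem_image_of_mem _ hx)
    | succ n ih =>
      intro x hx
      rw [hKs] at hx
      simp only [mem_iUnion, mem_image] at hx
      obtain ⟨j, x', hx', rfl⟩ := hx
      obtain ⟨y, hy, hxy⟩ := hL.exists_infDist_eq_dist hL0 x'
      have hFy : F q j y ∈ L := by
        rw [hLs]; exact mem_iUnion.2 ⟨j, mem_image_of_mem _ hy⟩
      have h1 := Metric.infDist_le_dist_of_mem (x := F q j x') hFy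
      have h2 := ih x' hx'
      rw [dist_F] at h1
      rw [hxy] at h2
      rw [pow_succ]
      linarith
  intro x hx
  rw [← hL.isClosed.closure_eq, Metric.mem_closure_iff_infDist_zero hL0]
  have hlim : Tendsto (fun n : ℕ => (1 / 2 : ℝ) ^ n * C) atTop (𝓝 0) := by
    simpa using (tendsto_pow_atTop_nhds_zero_of_lt_one (r := (1 / 2 : ℝ))
      (by norm_num) (by norm_num)).mul_const C
  exact le_antisymm (ge_of_tendsto' hlim fun n => key n x hx) Metric.infDist_nonneg

/-- The gasket is the unique nonempty compact set `K` with `K = F_0 K ∪ F_1 K ∪ F_2 K`. -/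
theorem eq_gasket_iff (q : Fin 3 → Plane) (K : Set Plane) :
    (K.Nonempty ∧ IsCompact K ∧ K = ⋃ j, F q j '' K) ↔ K = gasket q := by
  constructor
  · rintro ⟨h0, hc, hs⟩
    exact (subset_of_selfSimilar q hc hs (isCompact_gasket q) (range_nonempty _)
      (gasket_eq q)).antisymm
      (subset_of_selfSimilar q (isCompact_gasket q) (gasket_eq q) hc h0 hs)
  · rintro rfl
    exact ⟨range_nonempty _, isCompact_gasket q, gasket_eq q⟩

/-- The boundary `V_0 = {q_0, q_1, q_2}` of the gasket. -/
def V0 (q : Fin 3 → Plane) : Set Plane := range q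

/-- The cell `F_w(SG)` of level `w.length`. -/
def cell (q : Fin 3 → Plane) (w : List (Fin 3)) : Set Plane := cellMap q w '' gasket q

/-- The standard measure: the self-similar probability measure giving mass `3⁻ⁿ` to each cell of
level `n`, that is, the law of the point whose address consists of independent letters, uniformly
distributed in `{0, 1, 2}`. -/
def standardMeasure (q : Fin 3 → Plane) : Measure Plane :=
  (Measure.infinitePi fun _ : ℕ => (PMF.uniformOfFintype (Fin 3)).toMeasure).map (address q)

/-! ### Graph energy, Laplacian, harmonic extension -/

/-- The renormalized graph energy form of level `m`,
`E_m(u, v) = (5/3)^m ∑_{x ∼_m y} (u x - u y) (v x - v y)`. The edges `x ∼_m y` are the three sides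
`{F_w q_i, F_w q_{i+1}}`, `i ∈ ℤ/3`, of the cells of the words `w` of length `m`. -/
def graphEnergy (q : Fin 3 → Plane) (m : ℕ) (u v : Plane → ℝ) : ℝ :=
  (5 / 3 : ℝ) ^ m * ∑ w : Fin m → Fin 3, ∑ i : Fin 3,
    (u (cellMap q (List.ofFn w) (q i)) - u (cellMap q (List.ofFn w) (q (i + 1)))) *
    (v (cellMap q (List.ofFn w) (q i)) - v (cellMap q (List.ofFn w) (q (i + 1))))

/-- `lim_m E_m(u, u) < ∞`. The sequence `E_m(u, u)` is nondecreasing in `m`, so this is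
boundedness. -/
def HasFiniteEnergy (q : Fin 3 → Plane) (u : Plane → ℝ) : Prop :=
  BddAbove (range fun m => graphEnergy q m u u)

/-- Test functions on a relatively open set `U` of the gasket: continuous functions of finite energy
on the gasket which vanish outside of a compact subset of `U`. -/
structure IsTestFunction (q : Fin 3 → Plane) (U : Set Plane) (v : Plane → ℝ) : Prop where
  continuousOn : ContinuousOn v (gasket q)
  finiteEnergy : HasFiniteEnergy q v
  compactSupport : ∃ K ⊆ U, IsCompact K ∧ ∀ x ∈ gasket q, x ∉ K → v x = 0

/-- `Δu = f` on the relatively open subset `U` of the gasket, in the weak sense: `u` and `f` are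
continuous on `U`, `u` has finite energy on every cell contained in `U` (it may have infinite energy
on all of `U`), and `E(u, v) = lim_m E_m(u, v) = - ∫ f v dx` for all test functions `v` on `U`.
For `m` large, `E_m(u, v)` only involves the values of `u` on `U`. -/
structure HasLaplacianOn (q : Fin 3 → Plane) (U : Set Plane) (u f : Plane → ℝ) : Prop where
  continuousOn_left : ContinuousOn u U
  continuousOn_right : ContinuousOn f U
  locallyFiniteEnergy : ∀ w : List (Fin 3), cell q w ⊆ U → HasFiniteEnergy q (u ∘ cellMap q w)
  weak : ∀ v : Plane → ℝ, IsTestFunction q U v →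
    Tendsto (fun m => graphEnergy q m u v) atTop (𝓝 (-∫ x in U, f x * v x ∂standardMeasure q))

/-- On the cell `F_w(SG)`, `u` is the continuous function produced from its values at the three
boundary points of the cell by the harmonic extension algorithm applied
infinitely many times: for each subcell `F_w F_v (SG)`, with vertices `p_l = F_w F_v q_l`, the value at
the midpoint `F_w F_v F_i q_j` of `p_i` and `p_j` is `(2 u(p_i) + 2 u(p_j) + u(p_k)) / 5`. -/
structure IsHarmonicExtensionOnCell (q : Fin 3 → Plane) (w : List (Fin 3)) (u : Plane → ℝ) :
    Prop where
  continuousOn : ContinuousOn u (cell q w)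
  rule : ∀ (v : List (Fin 3)) (i j k : Fin 3), i ≠ j → j ≠ k → i ≠ k →
    u (cellMap q (w ++ v) (F q i (q j))) =
      (2 * u (cellMap q (w ++ v) (q i)) + 2 * u (cellMap q (w ++ v) (q j)) +
        u (cellMap q (w ++ v) (q k))) / 5

/-! ### The half gasket -/

/-- `h` is (on the gasket) the skew-symmetric harmonic function `h_s` with
`(h_s(q_0), h_s(q_1), h_s(q_2)) = (0, 1, -1)`. -/
structure IsSkewHarmonic (q : Fin 3 → Plane) (h : Plane → ℝ) : Prop where
  harmonic : IsHarmonicExtensionOnCell q [] h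
  value_zero : h (q 0) = 0
  value_one : h (q 1) = 1
  value_two : h (q 2) = -1

/-- `Ω = {x ∈ SG \ V_0 : h_s(x) > 0}`. -/
def Omega (q : Fin 3 → Plane) : Set Plane :=
  {x | x ∈ gasket q \ V0 q ∧ ∃ h, IsSkewHarmonic q h ∧ 0 < h x}

/-- `X = {x ∈ SG \ V_0 : h_s(x) = 0}`. -/
def X (q : Fin 3 → Plane) : Set Plane :=
  {x | x ∈ gasket q \ V0 q ∧ ∃ h, IsSkewHarmonic q h ∧ h x = 0}

/-- `∂Ω = {q_0, q_1} ∪ X`. -/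
def boundaryOmega (q : Fin 3 → Plane) : Set Plane := {q 0, q 1} ∪ X q

/-- `Ω ∪ ∂Ω`. -/
def closureOmega (q : Fin 3 → Plane) : Set Plane := Omega q ∪ boundaryOmega q

/-- `x_m = F_0^{m-1} F_2 q_1`, for `m ≥ 1`. -/
def xPt (q : Fin 3 → Plane) (m : ℕ) : Plane := (F q 0)^[m - 1] (F q 2 (q 1))

/-- `y_m = F_0^m q_1`, for `m ≥ 0`; so `y_0 = q_1`. -/
def yPt (q : Fin 3 → Plane) (m : ℕ) : Plane := (F q 0)^[m] (q 1)

/-- `u` is, on `Ω ∪ ∂Ω` without `q_0`, the harmonic extension of the values `u(x_m) = a_m` (`m ≥ 1`)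
and `u(y_m) = b_m` (`m ≥ 0`): it takes these values and, on each of the cells `F_0^{m-1} F_1 (SG)`
(`m ≥ 1`) with boundary points `x_m, y_{m-1}, y_m`, it is given by the harmonic extension
algorithm. -/
structure IsHarmonicExtension (q : Fin 3 → Plane) (a b : ℕ → ℝ) (u : Plane → ℝ) : Prop where
  harmonic : ∀ m : ℕ, 1 ≤ m → IsHarmonicExtensionOnCell q (List.replicate (m - 1) 0 ++ [1]) u
  value_x : ∀ m : ℕ, 1 ≤ m → u (xPt q m) = a m
  value_y : ∀ m : ℕ, u (yPt q m) = b m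

/-- The Dirichlet problem on `Ω`: `Δu = 0` on `Ω`, `u(q_1) = a_0`, `u(x_m) = a_m` for `m ≥ 1`. -/
structure SolvesBVP (q : Fin 3 → Plane) (a : ℕ → ℝ) (u : Plane → ℝ) : Prop where
  laplacian : HasLaplacianOn q (Omega q) u 0
  value_q : u (q 1) = a 0
  value_x : ∀ m : ℕ, 1 ≤ m → u (xPt q m) = a m

end HalfGasket

end

/-!
# The Dirichlet problem on the half gasket

The cells `F_0^m F_1 SG` (`m ≥ 0`, word `strip m`) make up the half gasket except for `q_0`;
consecutive ones share the point `y_{m+1}`, and the cell of index `m` has the boundary point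
`x_{m+1}` at which the boundary value `a (m + 1)` is prescribed (`closureOmega_eq`, which rests on
the signs of the skew-symmetric harmonic function, `IsHarmonic.skew_sign`).

A continuous function with the prescribed boundary values solves the problem if and only if it is
harmonic on each of these cells and its normal derivatives match at the points `y_{m+1}`. In terms
of `b m = u (y_m)` the matching is the recurrence
`16 b_{m+1} = 3 b_m + 5 b_{m+2} + 3 a_{m+1} + 5 a_{m+2}`, whose homogeneous part has the characteristic
roots `3` and `1/5`. The explicit formula for `b` is the bounded solution with `b_0 = a_0`
(`vertexValue_recurrence`, `tendsto_vertexValue`).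

* Existence: the harmonic extension is continuous at `q_0` by the maximum principle
  (`IsHarmonicExtension.continuousOn`). The energy against a test function is a sum over the cells
  `F_0^m F_1 SG`, which telescopes by the recurrence to a term that vanishes at high levels, as
  the test function vanishes near `q_0` (`IsHarmonicExtension.solvesBVP`).
* Uniqueness: testing with piecewise harmonic functions which are `1` at one junction point shows
  that normal derivatives of a weak solution match at all junction points
  (`HasLaplacianOn.flux_add_flux`), so that it obeys the harmonic extension rule on every cell
  contained in `Ω`. A cell which touches the boundary in a corner is not contained in `Ω`: there
  the matching conditions on the cells shrinking to the corner form a linear recurrence, and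
  continuity at the corner selects the solution which is harmonic up to the corner
  (`HasLaplacianOn.midpointRule_corner`). The difference of two continuous solutions then
  satisfies the homogeneous recurrence at the points `y_m`, is bounded and starts with `0`, so it
  vanishes (`SolvesBVP.eqOn`).

Harmonic functions with given vertex values are obtained as uniform limits of functions glued from
the three cells of level one (`exists_isHarmonic`); gluing uses that these cells meet only in
single points (`eq_vertex_of_F_eq`).
-/

namespace HalfGasket

variable {q : Fin 3 → Plane}

/-! ### Geometry of the gasket -/

lemma F_self (q : Fin 3 → Plane) (j : Fin 3) : F q j (q j) = q j := by
  rw [F, ← two_smul ℝ (q j), smul_smul]; norm_num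

lemma F_comm (q : Fin 3 → Plane) (i j : Fin 3) : F q i (q j) = F q j (q i) := by
  rw [F, F, add_comm]

lemma F_injective (q : Fin 3 → Plane) (j : Fin 3) : Function.Injective (F q j) := by
  intro x y h
  have := dist_F q j x y
  rw [h, dist_self] at this
  exact dist_eq_zero.1 (by linarith)

lemma continuous_F (q : Fin 3 → Plane) (j : Fin 3) : Continuous (F q j) := by
  unfold F; fun_prop

lemma iterate_F_self (q : Fin 3 → Plane) (j : Fin 3) (n : ℕ) : (F q j)^[n] (q j) = q j :=
  Function.iterate_fixed (F_self q j) n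

lemma cellMap_append (q : Fin 3 → Plane) (w v : List (Fin 3)) (x : Plane) :
    cellMap q (w ++ v) x = cellMap q w (cellMap q v x) := by
  induction w with
  | nil => rfl
  | cons i w ih => simp [cellMap, ih]

lemma cellMap_replicate (q : Fin 3 → Plane) (n : ℕ) (i : Fin 3) :
    cellMap q (List.replicate n i) = (F q i)^[n] := by
  induction n with
  | zero => rfl
  | succ n ih =>
    funext x
    rw [List.replicate_succ, cellMap, ih, Function.iterate_succ_apply']

lemma continuous_cellMap (q : Fin 3 → Plane) (w : List (Fin 3)) : Continuous (cellMap q w) := by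
  induction w with
  | nil => exact continuous_id
  | cons i w ih => exact (continuous_F q i).comp ih

lemma cellMap_injective (q : Fin 3 → Plane) (w : List (Fin 3)) :
    Function.Injective (cellMap q w) := by
  induction w with
  | nil => exact Function.injective_id
  | cons i w ih => exact (F_injective q i).comp ih

lemma dist_cellMap (q : Fin 3 → Plane) (w : List (Fin 3)) (x y : Plane) :
    dist (cellMap q w x) (cellMap q w y) = (1 / 2 : ℝ) ^ w.length * dist x y := by
  induction w with
  | nil => simp [cellMap]
  | cons i w ih => rw [cellMap, cellMap, dist_F, ih, List.length_cons, pow_succ]; ring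

lemma F_mem_gasket {x : Plane} (hx : x ∈ gasket q) (j : Fin 3) : F q j x ∈ gasket q := by
  rw [gasket_eq]
  exact mem_iUnion.2 ⟨j, mem_image_of_mem _ hx⟩

lemma vertex_mem_gasket (q : Fin 3 → Plane) (j : Fin 3) : q j ∈ gasket q := by
  refine ⟨fun _ => j, ?_⟩
  have h := address_eq q fun _ => j
  have h2 := dist_F q j (address q fun _ => j) (q j)
  rw [F_self, ← h] at h2
  exact dist_eq_zero.1 (by linarith)

lemma cellMap_mem_gasket {x : Plane} (hx : x ∈ gasket q) (w : List (Fin 3)) :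
    cellMap q w x ∈ gasket q := by
  induction w with
  | nil => exact hx
  | cons i w ih => exact F_mem_gasket ih i

lemma iterate_F_mem_gasket {x : Plane} (hx : x ∈ gasket q) (j : Fin 3) (n : ℕ) :
    (F q j)^[n] x ∈ gasket q := by
  rw [← cellMap_replicate]; exact cellMap_mem_gasket hx _

lemma exists_eq_F {x : Plane} (hx : x ∈ gasket q) : ∃ j, ∃ y ∈ gasket q, F q j y = x := by
  rw [gasket_eq] at hx
  simpa using hx

lemma exists_eq_cellMap (n : ℕ) : ∀ {x : Plane}, x ∈ gasket q →
    ∃ w : List (Fin 3), w.length = n ∧ ∃ y ∈ gasket q, cellMap q w y = x := by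
  induction n with
  | zero => intro x hx; exact ⟨[], rfl, x, hx, rfl⟩
  | succ n ih =>
    intro x hx
    obtain ⟨j, y, hy, rfl⟩ := exists_eq_F hx
    obtain ⟨w, hw, z, hz, rfl⟩ := ih hy
    exact ⟨j :: w, by simp [hw], z, hz, rfl⟩

lemma isCompact_cell (q : Fin 3 → Plane) (w : List (Fin 3)) : IsCompact (cell q w) :=
  (isCompact_gasket q).image (continuous_cellMap q w)

lemma cell_append_subset (q : Fin 3 → Plane) (w v : List (Fin 3)) :
    cell q (w ++ v) ⊆ cell q w := by
  rintro _ ⟨x, hx, rfl⟩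
  exact ⟨_, cellMap_mem_gasket hx v, (cellMap_append q w v x).symm⟩

/-- The barycentric coordinates with respect to `q 0, q 1, q 2`. -/
lemma exists_barycentric (hq : AffineIndependent ℝ q) : ∃ l : Fin 3 → Plane → ℝ,
    (∀ i, Continuous (l i)) ∧
    (∀ i j x, l i (F q j x) = (l i x + if i = j then 1 else 0) / 2) ∧
    (∀ i j, l i (q j) = if i = j then 1 else 0) ∧ (∀ x, ∑ i, l i x = 1) ∧
    ∀ x y, (∀ i, l i x = l i y) → x = y := by
  have hspan : affineSpan ℝ (range q) = ⊤ := by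
    rw [hq.affineSpan_eq_top_iff_card_eq_finrank_add_one]
    simp
  let b : AffineBasis (Fin 3) ℝ Plane := ⟨q, hq, hspan⟩
  have hb : ∀ i j, b.coord i (q j) = if i = j then 1 else 0 := fun i j => b.coord_apply i j
  refine ⟨fun i => b.coord i, fun i => (b.coord i).continuous_of_finiteDimensional, ?_, hb,
    fun x => b.sum_coord_apply_eq_one x, fun x y h => b.ext_elem h⟩
  intro i j x
  have h : F q j x = midpoint ℝ x (q j) := by
    rw [F, midpoint_eq_smul_add]; norm_num
  simp only [h, AffineMap.map_midpoint, hb]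
  rw [midpoint_eq_smul_add, smul_eq_mul, invOf_eq_inv]
  ring

/-- The gasket lies in the triangle: a barycentric coordinate has a minimum `m` on the gasket,
and self-similarity gives `m ≥ m / 2`. -/
lemma barycentric_nonneg {f : Plane → ℝ} (hf : Continuous f) {i : Fin 3}
    (hF : ∀ j x, f (F q j x) = (f x + if i = j then 1 else 0) / 2) {x : Plane}
    (hx : x ∈ gasket q) : 0 ≤ f x := by
  obtain ⟨z, hz, hmin⟩ := (isCompact_gasket q).exists_isMinOn ⟨x, hx⟩ hf.continuousOn
  obtain ⟨j, y, hy, rfl⟩ := exists_eq_F hz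
  have h1 : f (F q j y) ≤ f y := hmin hy
  have h2 : f (F q j y) ≤ f x := hmin hx
  rw [hF] at h1 h2
  split_ifs at h1 h2 <;> linarith

/-- Two distinct cells `F_i SG` and `F_j SG` meet only in the point `F_i q_j = F_j q_i`. -/
lemma eq_vertex_of_F_eq (hq : AffineIndependent ℝ q) {i j : Fin 3} (hij : i ≠ j) {x y : Plane}
    (hx : x ∈ gasket q) (hy : y ∈ gasket q) (h : F q i x = F q j y) : x = q j := by
  obtain ⟨l, hc, hF, hv, hs, hext⟩ := exists_barycentric hq
  have hn : ∀ k, ∀ z ∈ gasket q, 0 ≤ l k z := fun k z hz =>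
    barycentric_nonneg (hc k) (hF k) hz
  have h1 := congrArg (l j) h
  rw [hF, hF, if_neg hij.symm, if_pos rfl] at h1
  have h2 := hn j y hy
  have h3 : ∀ k, k ≠ j → l k x = 0 := by
    intro k hk
    have h4 := hs x
    have h5 := Finset.add_sum_erase Finset.univ (fun i => l i x) (Finset.mem_univ j)
    have h6 : l k x ≤ ∑ i ∈ Finset.univ.erase j, l i x :=
      Finset.single_le_sum (f := fun i => l i x) (fun i _ => hn i x hx)
        (Finset.mem_erase.2 ⟨hk, Finset.mem_univ k⟩)
    have h7 := hn k x hx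
    linarith
  refine hext _ _ fun k => ?_
  rw [hv]
  split_ifs with hk
  · subst hk
    have h4 := hs x
    rwa [Finset.sum_eq_single k (fun i _ hi => h3 i hi) (by simp)] at h4
  · exact h3 k hk

lemma vertex_injective (hq : AffineIndependent ℝ q) : Function.Injective q := hq.injective

lemma F_eq_vertex (hq : AffineIndependent ℝ q) {i j : Fin 3} {x : Plane} (hx : x ∈ gasket q)
    (h : F q i x = q j) : i = j ∧ x = q j := by
  by_cases hij : i = j
  · subst hij
    exact ⟨rfl, F_injective q i (h.trans (F_self q i).symm)⟩
  · have h1 : F q i x = F q j (q j) := by rw [F_self, h]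
    have h2 := eq_vertex_of_F_eq hq (Ne.symm hij) (vertex_mem_gasket q j) hx h1.symm
    exact absurd (vertex_injective hq h2).symm hij

lemma iterate_F_eq_vertex (hq : AffineIndependent ℝ q) {i j : Fin 3} (n : ℕ) {x : Plane}
    (hx : x ∈ gasket q) (h : (F q i)^[n] x = q j) : x = q j := by
  induction n with
  | zero => exact h
  | succ n ih =>
    rw [Function.iterate_succ_apply'] at h
    exact ih (F_eq_vertex hq (iterate_F_mem_gasket hx i n) h).2

lemma cellMap_eq_vertex (hq : AffineIndependent ℝ q) {j : Fin 3} (w : List (Fin 3)) {x : Plane}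
    (hx : x ∈ gasket q) (h : cellMap q w x = q j) : x = q j := by
  induction w with
  | nil => exact h
  | cons i w ih => exact ih (F_eq_vertex hq (cellMap_mem_gasket hx w) h).2

/-- Every point of the gasket other than `q_k` lies in one of the cells `F_k^n F_i SG`, `i ≠ k`. -/
lemma eq_vertex_or_exists_iterate (k : Fin 3) {x : Plane} (hx : x ∈ gasket q) :
    x = q k ∨ ∃ (n : ℕ) (i : Fin 3), i ≠ k ∧ ∃ y ∈ gasket q, x = (F q k)^[n] (F q i y) := by
  obtain ⟨ω, rfl⟩ := hx
  by_cases h : ∃ n, ω n ≠ k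
  · right
    classical
    obtain ⟨n, hn⟩ : ∃ n, n = Nat.find h := ⟨_, rfl⟩
    have h1 := Nat.find_spec h
    have h2 : ∀ m < n, ω m = k := fun m hm => by
      have := Nat.find_min h (hn ▸ hm)
      simpa using this
    rw [← hn] at h1
    clear hn h
    induction n generalizing ω with
    | zero => exact ⟨0, ω 0, h1, _, ⟨_, rfl⟩, address_eq q ω⟩
    | succ n ih =>
      obtain ⟨m, i, hi, y, hy, he⟩ := ih (fun m => ω (m + 1)) h1
        (fun m hm => h2 (m + 1) (by omega))
      refine ⟨m + 1, i, hi, y, hy, ?_⟩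
      rw [address_eq, he, h2 0 (by omega), Function.iterate_succ_apply']
  · left
    push Not at h
    have h1 : ω = fun _ => k := funext h
    rw [h1]
    have h := address_eq q fun _ => k
    have h2 := dist_F q k (address q fun _ => k) (q k)
    rw [F_self, ← h] at h2
    exact dist_eq_zero.1 (by linarith)

/-! ### Gluing functions along the three cells of level one -/

open Classical in
/-- The function on the gasket which is `g j ∘ (F_j)⁻¹` on the cell `F_j SG`. The choice of `j` is
immaterial when the `g j` agree at the three junction points, see `glue_apply`; outside of the
gasket the value is `0`. -/
noncomputable def glue (q : Fin 3 → Plane) (g : Fin 3 → Plane → ℝ) (x : Plane) : ℝ :=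
  if h : ∃ j, ∃ y ∈ gasket q, F q j y = x then g h.choose h.choose_spec.choose else 0

lemma glue_apply (hq : AffineIndependent ℝ q) {g : Fin 3 → Plane → ℝ}
    (hg : ∀ i j, g i (q j) = g j (q i)) (j : Fin 3) {y : Plane} (hy : y ∈ gasket q) :
    glue q g (F q j y) = g j y := by
  have h : ∃ i, ∃ z ∈ gasket q, F q i z = F q j y := ⟨j, y, hy, rfl⟩
  rw [glue, dif_pos h]
  obtain ⟨hz, he⟩ := h.choose_spec.choose_spec
  generalize h.choose_spec.choose = z at hz he ⊢
  generalize h.choose = i at he ⊢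
  by_cases hij : i = j
  · subst hij
    rw [F_injective q i he]
  · rw [eq_vertex_of_F_eq hq hij hz hy he, eq_vertex_of_F_eq hq (Ne.symm hij) hy hz he.symm, hg]

lemma continuousOn_image_of_comp {f : Plane → Plane} (hf : Continuous f) {K : Set Plane}
    (hK : IsCompact K) {G : Plane → ℝ} (hG : ContinuousOn (G ∘ f) K) :
    ContinuousOn G (f '' K) := by
  rw [continuousOn_iff_isClosed]
  intro t ht
  obtain ⟨u, hu, he⟩ := continuousOn_iff_isClosed.1 hG t ht
  refine ⟨f '' (u ∩ K), ((hK.inter_left hu).image hf).isClosed, ?_⟩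
  rw [← he]
  ext x
  constructor
  · rintro ⟨hx, y, hy, rfl⟩
    exact ⟨⟨y, ⟨hx, hy⟩, rfl⟩, mem_image_of_mem _ hy⟩
  · rintro ⟨⟨y, ⟨h1, h2⟩, rfl⟩, h3⟩
    exact ⟨h1, h3⟩

lemma continuousOn_gasket_of_comp_F {G : Plane → ℝ}
    (hG : ∀ j, ContinuousOn (G ∘ F q j) (gasket q)) : ContinuousOn G (gasket q) := by
  rw [gasket_eq]
  refine LocallyFinite.continuousOn_iUnion (locallyFinite_of_finite _)
    (fun j => ((isCompact_gasket q).image (continuous_F q j)).isClosed) fun j => ?_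
  exact continuousOn_image_of_comp (continuous_F q j) (isCompact_gasket q) (hG j)

lemma continuousOn_glue (hq : AffineIndependent ℝ q) {g : Fin 3 → Plane → ℝ}
    (hg : ∀ i j, g i (q j) = g j (q i)) (hc : ∀ j, ContinuousOn (g j) (gasket q)) :
    ContinuousOn (glue q g) (gasket q) :=
  continuousOn_gasket_of_comp_F fun j => (hc j).congr fun _ hy => glue_apply hq hg j hy

/-! ### Harmonic functions on the gasket -/

/-- The harmonic extension rule at the three midpoints of the sides of the triangle `V_0`. -/
def MidpointRule (q : Fin 3 → Plane) (g : Plane → ℝ) : Prop :=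
  ∀ i j k : Fin 3, i ≠ j → j ≠ k → i ≠ k →
    g (F q i (q j)) = (2 * g (q i) + 2 * g (q j) + g (q k)) / 5

/-- The harmonic extension rule on all cells of the gasket. Functions on a cell `F_w SG` are treated
by applying this notion to `u ∘ F_w`. -/
def IsHarmonic (q : Fin 3 → Plane) (g : Plane → ℝ) : Prop :=
  ∀ v : List (Fin 3), MidpointRule q (g ∘ cellMap q v)

lemma isHarmonicExtensionOnCell_iff {w : List (Fin 3)} {u : Plane → ℝ} :
    IsHarmonicExtensionOnCell q w u ↔
      ContinuousOn (u ∘ cellMap q w) (gasket q) ∧ IsHarmonic q (u ∘ cellMap q w) := by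
  constructor
  · rintro ⟨hc, hr⟩
    refine ⟨hc.comp (continuous_cellMap q w).continuousOn (mapsTo_image _ _), ?_⟩
    intro v i j k hij hjk hik
    simpa only [cellMap_append, Function.comp_apply] using hr v i j k hij hjk hik
  · rintro ⟨hc, hr⟩
    refine ⟨continuousOn_image_of_comp (continuous_cellMap q w) (isCompact_gasket q) hc, ?_⟩
    intro v i j k hij hjk hik
    simpa only [cellMap_append, Function.comp_apply] using hr v i j k hij hjk hik

lemma IsHarmonic.midpointRule {g : Plane → ℝ} (hg : IsHarmonic q g) : MidpointRule q g := hg []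

lemma IsHarmonic.comp_F {g : Plane → ℝ} (hg : IsHarmonic q g) (j : Fin 3) :
    IsHarmonic q (g ∘ F q j) := fun v => hg (j :: v)

lemma IsHarmonic.comp_cellMap {g : Plane → ℝ} (hg : IsHarmonic q g) (w : List (Fin 3)) :
    IsHarmonic q (g ∘ cellMap q w) := by
  intro v i j k hij hjk hik
  simpa only [cellMap_append, Function.comp_apply] using hg (w ++ v) i j k hij hjk hik

lemma MidpointRule.congr {g h : Plane → ℝ} (hg : MidpointRule q g) (he : EqOn g h (gasket q)) :
    MidpointRule q h := by
  intro i j k hij hjk hik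
  have hv := vertex_mem_gasket q
  rw [← he (F_mem_gasket (hv j) i), ← he (hv i), ← he (hv j), ← he (hv k), hg i j k hij hjk hik]

lemma IsHarmonic.congr {g h : Plane → ℝ} (hg : IsHarmonic q g) (he : EqOn g h (gasket q)) :
    IsHarmonic q h :=
  fun v => (hg v).congr fun _ hx => he (cellMap_mem_gasket hx v)

lemma IsHarmonic.neg {g : Plane → ℝ} (hg : IsHarmonic q g) : IsHarmonic q (fun x => -g x) := by
  intro v i j k hij hjk hik
  have := hg v i j k hij hjk hik
  simp only [Function.comp_apply] at this ⊢
  rw [this]; ring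

lemma IsHarmonic.sub {g h : Plane → ℝ} (hg : IsHarmonic q g) (hh : IsHarmonic q h) :
    IsHarmonic q (fun x => g x - h x) := by
  intro v i j k hij hjk hik
  have h1 := hg v i j k hij hjk hik
  have h2 := hh v i j k hij hjk hik
  simp only [Function.comp_apply] at h1 h2 ⊢
  rw [h1, h2]; ring

/-- The values `c` of a harmonic function at the vertices `q_i` determine its values
`subcellValues j c i` at the vertices `F_j q_i` of the cell `F_j SG`. -/
noncomputable def subcellValues (j : Fin 3) (c : Fin 3 → ℝ) (i : Fin 3) : ℝ :=
  if i = j then c j else (c i + c j + ∑ k, c k) / 5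

lemma subcellValues_self (j : Fin 3) (c : Fin 3 → ℝ) : subcellValues j c j = c j := if_pos rfl

lemma subcellValues_comm (i j : Fin 3) (c : Fin 3 → ℝ) :
    subcellValues i c j = subcellValues j c i := by
  unfold subcellValues
  split_ifs with h1 h2 h2
  · rw [h1]
  · exact absurd h1.symm h2
  · exact absurd h2.symm h1
  · ring

lemma sum_eq_of_distinct (c : Fin 3 → ℝ) {i j k : Fin 3} (hij : i ≠ j) (hjk : j ≠ k)
    (hik : i ≠ k) : ∑ l, c l = c i + c j + c k := by
  have : (Finset.univ : Finset (Fin 3)) = {i, j, k} := by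
    revert i j k; decide
  rw [this, Finset.sum_insert (by simp [hij, hik]), Finset.sum_pair hjk]; ring

lemma exists_third (i j : Fin 3) (h : i ≠ j) : ∃ k, j ≠ k ∧ i ≠ k := by
  revert i j; decide

lemma MidpointRule.apply_F {g : Plane → ℝ} (hg : MidpointRule q g) (j i : Fin 3) :
    g (F q j (q i)) = subcellValues j (g ∘ q) i := by
  unfold subcellValues
  split_ifs with h
  · rw [h, F_self, Function.comp_apply]
  · obtain ⟨k, h1, h2⟩ := exists_third i j h
    rw [hg j i k (Ne.symm h) h2 h1, sum_eq_of_distinct _ h h1 h2]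
    simp only [Function.comp_apply]; ring

lemma midpointRule_of_apply_F {g : Plane → ℝ}
    (hg : ∀ j i, g (F q j (q i)) = subcellValues j (g ∘ q) i) : MidpointRule q g := by
  intro i j k hij hjk hik
  rw [hg, subcellValues, if_neg hij.symm, sum_eq_of_distinct _ hij hjk hik]
  simp only [Function.comp_apply]; ring

lemma subcellValues_le {c : Fin 3 → ℝ} {M : ℝ} (hc : ∀ i, c i ≤ M) (j i : Fin 3) :
    subcellValues j c i ≤ M := by
  unfold subcellValues
  split_ifs
  · exact hc j
  · have h0 := hc 0
    have h1 := hc 1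
    have h2 := hc 2
    have := hc i
    have := hc j
    rw [Fin.sum_univ_three]
    linarith

lemma gasket_subset_closure_vertices (q : Fin 3 → Plane) :
    gasket q ⊆ closure (range fun w => cellMap q w (q 0)) := by
  intro x hx
  obtain ⟨C, hC⟩ := (isCompact_gasket q).isBounded.subset_closedBall (q 0)
  rw [Metric.mem_closure_range_iff]
  intro ε hε
  have hlim : Tendsto (fun n : ℕ => (1 / 2 : ℝ) ^ n * C) atTop (𝓝 0) := by
    simpa using (tendsto_pow_atTop_nhds_zero_of_lt_one (r := (1 / 2 : ℝ))
      (by norm_num) (by norm_num)).mul_const C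
  obtain ⟨n, hn⟩ := (hlim.eventually (gt_mem_nhds hε)).exists
  obtain ⟨w, hw, y, hy, rfl⟩ := exists_eq_cellMap n hx
  refine ⟨w, lt_of_le_of_lt ?_ hn⟩
  rw [dist_cellMap, hw]
  gcongr
  exact hC hy

/-- The maximum principle for harmonic functions. -/
lemma IsHarmonic.le_of_vertices_le {g : Plane → ℝ} (hg : IsHarmonic q g)
    (hc : ContinuousOn g (gasket q)) {M : ℝ} (hM : ∀ i, g (q i) ≤ M) {x : Plane}
    (hx : x ∈ gasket q) : g x ≤ M := by
  have key : ∀ (w : List (Fin 3)) (g : Plane → ℝ), IsHarmonic q g → (∀ i, g (q i) ≤ M) →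
      ∀ i, g (cellMap q w (q i)) ≤ M := by
    intro w
    induction w with
    | nil => intro g _ h; exact h
    | cons j w ih =>
      intro g hg h
      refine ih (g ∘ F q j) (hg.comp_F j) fun i => ?_
      rw [Function.comp_apply, hg.midpointRule.apply_F]
      exact subcellValues_le h j i
  have hcl : IsClosed (gasket q ∩ g ⁻¹' Iic M) :=
    hc.preimage_isClosed_of_isClosed (isCompact_gasket q).isClosed isClosed_Iic
  have hsub : (range fun w => cellMap q w (q 0)) ⊆ gasket q ∩ g ⁻¹' Iic M := by
    rintro _ ⟨w, rfl⟩
    exact ⟨cellMap_mem_gasket (vertex_mem_gasket q 0) w, key w g hg hM 0⟩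
  exact (hcl.closure_subset_iff.2 hsub (gasket_subset_closure_vertices q hx)).2

lemma IsHarmonic.le_of_le_vertices {g : Plane → ℝ} (hg : IsHarmonic q g)
    (hc : ContinuousOn g (gasket q)) {M : ℝ} (hM : ∀ i, M ≤ g (q i)) {x : Plane}
    (hx : x ∈ gasket q) : M ≤ g x := by
  have := hg.neg.le_of_vertices_le hc.neg (M := -M) (fun i => neg_le_neg (hM i)) hx
  linarith

lemma IsHarmonic.eqOn {g h : Plane → ℝ} (hg : IsHarmonic q g) (hgc : ContinuousOn g (gasket q))
    (hh : IsHarmonic q h) (hhc : ContinuousOn h (gasket q)) (he : ∀ i, g (q i) = h (q i)) :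
    EqOn g h (gasket q) := by
  intro x hx
  have h1 := (hg.sub hh).le_of_vertices_le (hgc.sub hhc) (M := 0) (fun i => by simp [he]) hx
  have h2 := (hg.sub hh).le_of_le_vertices (hgc.sub hhc) (M := 0) (fun i => by simp [he]) hx
  linarith

lemma subcellValues_osc {c : Fin 3 → ℝ} {K : ℝ} (hc : ∀ i j, c i - c j ≤ K) (k i j : Fin 3) :
    subcellValues k c i - subcellValues k c j ≤ 3 / 5 * K := by
  have h01 := hc 0 1
  have h02 := hc 0 2
  have h10 := hc 1 0
  have h12 := hc 1 2
  have h20 := hc 2 0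
  have h21 := hc 2 1
  unfold subcellValues
  rw [Fin.sum_univ_three]
  fin_cases k <;> fin_cases i <;> fin_cases j <;> simp <;> linarith

/-- Approximations of the harmonic function with the values `c` on `V_0`: affine on each cell of
level `n`, when `l` are the barycentric coordinates. -/
noncomputable def harmonicApprox (q : Fin 3 → Plane) (l : Fin 3 → Plane → ℝ) :
    ℕ → (Fin 3 → ℝ) → Plane → ℝ
  | 0, c => fun x => ∑ i, c i * l i x
  | n + 1, c => glue q fun j => harmonicApprox q l n (subcellValues j c)

/-- Existence of the harmonic function with given values on `V_0`, as the uniform limit of the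
functions `harmonicApprox`: the oscillation of the vertex values contracts by `3/5` per level. -/
lemma exists_isHarmonic (hq : AffineIndependent ℝ q) (c : Fin 3 → ℝ) :
    ∃ h : Plane → ℝ, ContinuousOn h (gasket q) ∧ IsHarmonic q h ∧ ∀ i, h (q i) = c i := by
  obtain ⟨l, hlc, hlF, hlv, hls, -⟩ := exists_barycentric hq
  have hln : ∀ k, ∀ z ∈ gasket q, 0 ≤ l k z := fun k z hz =>
    barycentric_nonneg (hlc k) (hlF k) hz
  have hF : ∀ j, F q j (q j) = q j := F_self q
  have hv : ∀ n c j, harmonicApprox q l n c (q j) = c j ∧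
      ∀ x ∈ gasket q, harmonicApprox q l (n + 1) c (F q j x) =
        harmonicApprox q l n (subcellValues j c) x := by
    intro n
    induction n with
    | zero =>
      intro c j
      have h0 : ∀ c j, harmonicApprox q l 0 c (q j) = c j := by
        intro c j
        simp [harmonicApprox, hlv]
      refine ⟨h0 c j, fun x hx => ?_⟩
      change glue q (fun j => harmonicApprox q l 0 (subcellValues j c)) (F q j x) = _
      rw [glue_apply hq _ j hx]
      intro i j
      rw [h0, h0, subcellValues_comm]
    | succ n ih =>
      intro c j
      have h1 : ∀ c j, harmonicApprox q l (n + 1) c (q j) = c j := by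
        intro c j
        have h := (ih c j).2 (q j) (vertex_mem_gasket q j)
        rw [hF, (ih _ j).1, subcellValues_self] at h
        exact h
      refine ⟨h1 c j, fun x hx => ?_⟩
      rw [harmonicApprox, glue_apply hq _ j hx]
      intro i j
      rw [h1, h1, subcellValues_comm]
  have hcont : ∀ n c, ContinuousOn (harmonicApprox q l n c) (gasket q) := by
    intro n
    induction n with
    | zero =>
      intro c
      exact (continuous_finsetSum _ fun i _ => (hlc i).const_mul (c i)).continuousOn
    | succ n ih =>
      intro c
      exact continuousOn_gasket_of_comp_F fun j => (ih _).congr fun x hx => (hv n c j).2 x hx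
  have hle : ∀ n c M, (∀ i, c i ≤ M) → ∀ x ∈ gasket q, harmonicApprox q l n c x ≤ M := by
    intro n
    induction n with
    | zero =>
      intro c M hM x hx
      calc ∑ i, c i * l i x ≤ ∑ i, M * l i x :=
            Finset.sum_le_sum fun i _ => mul_le_mul_of_nonneg_right (hM i) (hln i x hx)
        _ = M := by rw [← Finset.mul_sum, hls, mul_one]
    | succ n ih =>
      intro c M hM x hx
      obtain ⟨j, y, hy, rfl⟩ := exists_eq_F hx
      rw [(hv n c j).2 y hy]
      exact ih _ _ (subcellValues_le hM j) y hy
  have hge : ∀ n c M, (∀ i, M ≤ c i) → ∀ x ∈ gasket q, M ≤ harmonicApprox q l n c x := by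
    intro n
    induction n with
    | zero =>
      intro c M hM x hx
      calc M = ∑ i, M * l i x := by rw [← Finset.mul_sum, hls, mul_one]
        _ ≤ ∑ i, c i * l i x :=
            Finset.sum_le_sum fun i _ => mul_le_mul_of_nonneg_right (hM i) (hln i x hx)
    | succ n ih =>
      intro c M hM x hx
      obtain ⟨j, y, hy, rfl⟩ := exists_eq_F hx
      rw [(hv n c j).2 y hy]
      refine ih _ _ (fun i => ?_) y hy
      have := subcellValues_le (c := fun i => -c i) (M := -M) (fun i => neg_le_neg (hM i)) j i
      unfold subcellValues at this ⊢
      rw [Fin.sum_univ_three] at this ⊢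
      split_ifs at this ⊢ <;> linarith
  have hstep : ∀ n c K, (∀ i j, c i - c j ≤ K) → ∀ x ∈ gasket q,
      |harmonicApprox q l n c x - harmonicApprox q l (n + 1) c x| ≤ K * (3 / 5) ^ n := by
    intro n
    induction n with
    | zero =>
      intro c K hK x hx
      obtain ⟨i, -, hi⟩ := Finset.exists_max_image Finset.univ c ⟨0, Finset.mem_univ _⟩
      have h1 := fun n => hle n c (c i) (fun j => hi j (Finset.mem_univ j)) x hx
      have h2 := fun n => hge n c (c i - K) (fun j => by have := hK i j; linarith) x hx
      rw [abs_le, pow_zero]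
      constructor <;> linarith [h1 0, h1 (0 + 1), h2 0, h2 (0 + 1)]
    | succ n ih =>
      intro c K hK x hx
      obtain ⟨j, y, hy, rfl⟩ := exists_eq_F hx
      rw [(hv n c j).2 y hy, (hv (n + 1) c j).2 y hy]
      refine (ih _ _ (subcellValues_osc hK j) y hy).trans (le_of_eq ?_)
      ring
  have hosc : ∀ c : Fin 3 → ℝ, ∃ K, ∀ i j, c i - c j ≤ K := by
    intro c
    refine ⟨∑ p : Fin 3 × Fin 3, |c p.1 - c p.2|, fun i j => (le_abs_self _).trans ?_⟩
    exact Finset.single_le_sum (f := fun p : Fin 3 × Fin 3 => |c p.1 - c p.2|)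
      (fun _ _ => abs_nonneg _) (Finset.mem_univ (i, j))
  have hlim : ∀ c x, x ∈ gasket q →
      ∃ L, Tendsto (fun n => harmonicApprox q l n c x) atTop (𝓝 L) := by
    intro c x hx
    obtain ⟨K, hK⟩ := hosc c
    exact cauchySeq_tendsto_of_complete
      (cauchySeq_of_le_geometric (3 / 5) K (by norm_num) fun n => hstep n c K hK x hx)
  choose! H hH using hlim
  have hHF : ∀ c j x, x ∈ gasket q → H c (F q j x) = H (subcellValues j c) x := by
    intro c j x hx
    refine tendsto_nhds_unique ((tendsto_add_atTop_iff_nat 1).2 (hH c _ (F_mem_gasket hx j))) ?_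
    exact (hH _ x hx).congr fun n => ((hv n c j).2 x hx).symm
  have hHv : ∀ c j, H c (q j) = c j := fun c j =>
    tendsto_nhds_unique (hH c _ (vertex_mem_gasket q j))
      (tendsto_const_nhds.congr fun n => ((hv n c j).1).symm)
  have hHh : ∀ (v : List (Fin 3)) (c : Fin 3 → ℝ), MidpointRule q (H c ∘ cellMap q v) := by
    intro v
    induction v with
    | nil =>
      intro c
      refine midpointRule_of_apply_F fun j i => ?_
      simp only [Function.comp_def, cellMap]
      rw [hHF _ _ _ (vertex_mem_gasket q i), hHv]
      simp only [hHv]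
    | cons j v ih =>
      intro c
      exact (ih (subcellValues j c)).congr fun x hx =>
        (hHF c j _ (cellMap_mem_gasket hx v)).symm
  refine ⟨H c, ?_, fun v => hHh v c, hHv c⟩
  obtain ⟨K, hK⟩ := hosc c
  have hunif : TendstoUniformlyOn (fun n => harmonicApprox q l n c) (H c) atTop (gasket q) := by
    rw [Metric.tendstoUniformlyOn_iff]
    intro ε hε
    have h0 : Tendsto (fun n : ℕ => K * (3 / 5 : ℝ) ^ n / (1 - 3 / 5)) atTop (𝓝 0) := by
      simpa using ((tendsto_pow_atTop_nhds_zero_of_lt_one (r := (3 / 5 : ℝ))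
        (by norm_num) (by norm_num)).const_mul K).div_const (1 - 3 / 5)
    filter_upwards [h0.eventually (gt_mem_nhds hε)] with n hn x hx
    rw [dist_comm]
    exact (dist_le_of_le_geometric_of_tendsto (3 / 5) K (by norm_num)
      (fun n => hstep n c K hK x hx) (hH c x hx) n).trans_lt hn
  exact hunif.continuousOn (Frequently.of_forall fun n => hcont n c)

/-- The piecewise harmonic function of level `n` with the values of `f` at the vertices of the cells
of level `n`. -/
lemma exists_piecewise_harmonic (hq : AffineIndependent ℝ q) (n : ℕ) : ∀ f : Plane → ℝ,
    ∃ h : Plane → ℝ, ContinuousOn h (gasket q) ∧ ∀ w : List (Fin 3), w.length = n →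
      IsHarmonic q (h ∘ cellMap q w) ∧ ∀ i, h (cellMap q w (q i)) = f (cellMap q w (q i)) := by
  induction n with
  | zero =>
    intro f
    obtain ⟨h, h1, h2, h3⟩ := exists_isHarmonic hq (f ∘ q)
    refine ⟨h, h1, fun w hw => ?_⟩
    rw [List.length_eq_zero_iff.1 hw]
    exact ⟨h2, h3⟩
  | succ n ih =>
    intro f
    choose h h1 h2 using fun j => ih (f ∘ F q j)
    have hw : ∀ i j, h i (q j) = f (F q i (q j)) := by
      intro i j
      have := (h2 i (List.replicate n j) (List.length_replicate)).2 j
      rwa [cellMap_replicate, iterate_F_self] at this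
    have hg : ∀ i j, h i (q j) = h j (q i) := fun i j => by rw [hw, hw, F_comm]
    refine ⟨glue q h, continuousOn_glue hq hg h1, ?_⟩
    intro w hwl
    cases w with
    | nil => simp at hwl
    | cons j w =>
      obtain ⟨h3, h4⟩ := h2 j w (by simpa using hwl)
      refine ⟨h3.congr fun x hx => (glue_apply hq hg j (cellMap_mem_gasket hx w)).symm,
        fun i => ?_⟩
      rw [cellMap, glue_apply hq hg j (cellMap_mem_gasket (vertex_mem_gasket q i) w), h4]
      rfl

/-- A harmonic function which vanishes at one vertex and is positive at the other two vertices is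
positive on the rest of the gasket. -/
lemma IsHarmonic.pos {g : Plane → ℝ} (hg : IsHarmonic q g) (hc : ContinuousOn g (gasket q))
    {k : Fin 3} (h0 : g (q k) = 0) (hpos : ∀ i, i ≠ k → 0 < g (q i)) {x : Plane}
    (hx : x ∈ gasket q) (hxk : x ≠ q k) : 0 < g x := by
  obtain h | ⟨n, i, hi, y, hy, rfl⟩ := eq_vertex_or_exists_iterate k hx
  · exact absurd h hxk
  clear hxk hx
  have hsub : ∀ g : Plane → ℝ, IsHarmonic q g → g (q k) = 0 → (∀ i, i ≠ k → 0 < g (q i)) →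
      ∀ j i, (i = k → j ≠ k) → 0 < g (F q j (q i)) := by
    intro g hg h0 hpos j i hji
    have hnn : ∀ i, 0 ≤ g (q i) := by
      intro i
      by_cases hik : i = k
      · rw [hik, h0]
      · exact (hpos i hik).le
    rw [hg.midpointRule.apply_F, subcellValues]
    simp only [Function.comp_apply]
    split_ifs with hij
    · refine hpos j fun hj => ?_
      exact hji (hij.trans hj) hj
    · have h1 : 0 < g (q i) + g (q j) := by
        by_cases hik : i = k
        · linarith [hpos j (hji hik), hnn i]
        · linarith [hpos i hik, hnn j]
      have h2 : 0 ≤ ∑ k, g (q k) := Finset.sum_nonneg fun k _ => hnn k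
      positivity
  induction n generalizing g with
  | zero =>
    have hcF : ContinuousOn (g ∘ F q i) (gasket q) :=
      hc.comp (continuous_F q i).continuousOn fun _ hx => F_mem_gasket hx i
    obtain ⟨j, -, hj⟩ := Finset.exists_min_image Finset.univ (fun j => (g ∘ F q i) (q j))
      ⟨0, Finset.mem_univ _⟩
    exact (hsub g hg h0 hpos i j fun _ => hi).trans_le
      ((hg.comp_F i).le_of_le_vertices hcF (fun l => hj l (Finset.mem_univ l)) hy)
  | succ n ih =>
    have hcF : ContinuousOn (g ∘ F q k) (gasket q) :=
      hc.comp (continuous_F q k).continuousOn fun _ hx => F_mem_gasket hx k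
    rw [Function.iterate_succ_apply']
    exact ih (hg.comp_F k) hcF (by rw [Function.comp_apply, F_self, h0])
      fun i hi => hsub g hg h0 hpos k i fun h => absurd h hi

/-! ### Graph energies -/

lemma graphEnergy_zero (q : Fin 3 → Plane) (u v : Plane → ℝ) :
    graphEnergy q 0 u v = ∑ i : Fin 3, (u (q i) - u (q (i + 1))) * (v (q i) - v (q (i + 1))) := by
  simp [graphEnergy, cellMap]

lemma graphEnergy_succ (q : Fin 3 → Plane) (m : ℕ) (u v : Plane → ℝ) :
    graphEnergy q (m + 1) u v =
      5 / 3 * ∑ j, graphEnergy q m (u ∘ F q j) (v ∘ F q j) := by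
  unfold graphEnergy
  rw [← Finset.mul_sum, ← mul_assoc, pow_succ', ← (Fin.consEquiv fun _ => Fin 3).sum_comp,
    Fintype.sum_prod_type]
  simp [Fin.consEquiv, List.ofFn_succ, cellMap]

lemma graphEnergy_comm (q : Fin 3 → Plane) (m : ℕ) (u v : Plane → ℝ) :
    graphEnergy q m u v = graphEnergy q m v u := by
  unfold graphEnergy
  simp only [mul_comm]

lemma graphEnergy_congr {m : ℕ} {u u' v v' : Plane → ℝ} (hu : EqOn u u' (gasket q))
    (hv : EqOn v v' (gasket q)) : graphEnergy q m u v = graphEnergy q m u' v' := by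
  unfold graphEnergy
  have h : ∀ (w : Fin m → Fin 3) (i : Fin 3), cellMap q (List.ofFn w) (q i) ∈ gasket q :=
    fun w i => cellMap_mem_gasket (vertex_mem_gasket q i) _
  simp only [hu (h _ _), hv (h _ _)]

lemma graphEnergy_eq_zero_of_eqOn {m : ℕ} {u v : Plane → ℝ} (hv : EqOn v 0 (gasket q)) :
    graphEnergy q m u v = 0 := by
  rw [graphEnergy_congr (Set.eqOn_refl u _) hv]
  simp [graphEnergy]

lemma MidpointRule.graphEnergy_one {u : Plane → ℝ} (hu : MidpointRule q u) (v : Plane → ℝ) :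
    graphEnergy q 1 u v = graphEnergy q 0 u v := by
  rw [graphEnergy_succ]
  simp only [graphEnergy_zero, Fin.sum_univ_three, Function.comp_apply, F_self,
    F_comm q 1 0, F_comm q 2 0, F_comm q 2 1, zero_add,
    show (1 + 1 : Fin 3) = 2 from rfl, show (2 + 1 : Fin 3) = 0 from rfl]
  rw [hu 0 1 2 (by decide) (by decide) (by decide), hu 0 2 1 (by decide) (by decide) (by decide),
    hu 1 2 0 (by decide) (by decide) (by decide)]
  ring

lemma IsHarmonic.graphEnergy_eq {u : Plane → ℝ} (hu : IsHarmonic q u) (v : Plane → ℝ) (m : ℕ) :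
    graphEnergy q m u v = graphEnergy q 0 u v := by
  induction m generalizing u v with
  | zero => rfl
  | succ m ih =>
    rw [graphEnergy_succ, Finset.sum_congr rfl fun j _ => ih (hu.comp_F j) (v ∘ F q j),
      ← hu.midpointRule.graphEnergy_one, graphEnergy_succ]

lemma graphEnergy_piecewise_harmonic (n m : ℕ) {u : Plane → ℝ}
    (hu : ∀ w : List (Fin 3), w.length = n → IsHarmonic q (u ∘ cellMap q w)) (v : Plane → ℝ) :
    graphEnergy q (n + m) u v = graphEnergy q n u v := by
  induction n generalizing u v with
  | zero => rw [zero_add]; exact (hu [] rfl).graphEnergy_eq v m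
  | succ n ih =>
    rw [add_right_comm, graphEnergy_succ, graphEnergy_succ]
    congr 1
    exact Finset.sum_congr rfl fun j _ => ih (fun w hw => hu (j :: w) (by simp [hw])) _

lemma hasFiniteEnergy_of_piecewise_harmonic (n : ℕ) {u : Plane → ℝ}
    (hu : ∀ w : List (Fin 3), w.length = n → IsHarmonic q (u ∘ cellMap q w)) :
    HasFiniteEnergy q u := by
  refine Tendsto.bddAbove_range (a := graphEnergy q n u u) ?_
  refine tendsto_const_nhds.congr' ?_
  filter_upwards [eventually_ge_atTop n] with m hm
  obtain ⟨k, rfl⟩ := Nat.exists_eq_add_of_le hm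
  exact (graphEnergy_piecewise_harmonic n k hu u).symm

/-- The energy against the indicator of `F_w p`, where `p` is not a vertex of the gasket, is
computed inside of `F_w SG`, the only cell of its level which contains `F_w p`. -/
lemma graphEnergy_localize (hq : AffineIndependent ℝ q) (w : List (Fin 3)) {p : Plane}
    (hp : p ∈ gasket q) (hpv : p ∉ V0 q) (m : ℕ) (u : Plane → ℝ) :
    graphEnergy q (w.length + m) u (Pi.single (cellMap q w p) 1) =
      (5 / 3) ^ w.length * graphEnergy q m (u ∘ cellMap q w) (Pi.single p 1) := by
  induction w generalizing u with
  | nil => simp only [List.length_nil, zero_add, pow_zero, one_mul]; rfl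
  | cons i w ih =>
    have hD := cellMap_mem_gasket hp w
    rw [List.length_cons, add_right_comm, graphEnergy_succ, Finset.sum_eq_single i]
    · have h : (Pi.single (cellMap q (i :: w) p) (1 : ℝ) : Plane → ℝ) ∘ F q i =
          Pi.single (cellMap q w p) 1 := by
        funext x
        simp only [Function.comp_apply, Pi.single_apply, cellMap, (F_injective q i).eq_iff]
      rw [h, ih, pow_succ', mul_assoc]
      rfl
    · intro j _ hj
      refine graphEnergy_eq_zero_of_eqOn fun x hx => ?_
      simp only [Function.comp_apply, Pi.single_apply, cellMap, Pi.zero_apply]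
      refine if_neg fun h => hpv ?_
      have h1 := eq_vertex_of_F_eq hq (Ne.symm hj) hD hx h.symm
      exact ⟨j, (cellMap_eq_vertex hq w hp h1).symm⟩
    · simp

/-- The sum `∑_l (g (q_j) - g (q_l))` of the differences at the vertex `q_j`; for a harmonic
function `g` it is the normal derivative at `q_j`. -/
noncomputable def flux (q : Fin 3 → Plane) (g : Plane → ℝ) (j : Fin 3) : ℝ :=
  ∑ l, (g (q j) - g (q l))

lemma flux_eq (g : Plane → ℝ) {i j k : Fin 3} (hij : i ≠ j) (hjk : j ≠ k) (hik : i ≠ k) :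
    flux q g i = 2 * g (q i) - g (q j) - g (q k) := by
  rw [flux, sum_eq_of_distinct _ hij hjk hik]; ring

lemma MidpointRule.flux_comp_F {g : Plane → ℝ} (hg : MidpointRule q g) (j : Fin 3) :
    flux q (g ∘ F q j) j = 3 / 5 * flux q g j := by
  obtain ⟨i, k, hij, hjk, hik⟩ : ∃ i k : Fin 3, j ≠ i ∧ i ≠ k ∧ j ≠ k := by
    revert j; decide
  rw [flux_eq _ hij hjk hik, flux_eq _ hij hjk hik]
  simp only [Function.comp_apply, F_self]
  rw [hg j i k hij hjk hik, hg j k i hik hjk.symm hij]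
  ring

lemma graphEnergy_single_vertex (hq : AffineIndependent ℝ q) (j : Fin 3) (m : ℕ)
    (g : Plane → ℝ) :
    graphEnergy q m g (Pi.single (q j) 1) = (5 / 3) ^ m * flux q (g ∘ (F q j)^[m]) j := by
  induction m generalizing g with
  | zero =>
    have hv : ∀ i, (Pi.single (q j) (1 : ℝ) : Plane → ℝ) (q i) = if i = j then 1 else 0 := by
      intro i
      simp only [Pi.single_apply, (vertex_injective hq).eq_iff]
    rw [graphEnergy_zero, flux]
    simp only [hv, Fin.sum_univ_three, Function.iterate_zero, Function.comp_id]
    fin_cases j <;> simp <;> ring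
  | succ m ih =>
    rw [graphEnergy_succ, Finset.sum_eq_single j]
    · have h : (Pi.single (q j) (1 : ℝ) : Plane → ℝ) ∘ F q j = Pi.single (q j) 1 := by
        funext x
        simp only [Function.comp_apply, Pi.single_apply]
        congr 1
        exact propext ⟨fun h => F_injective q j (h.trans (F_self q j).symm),
          fun h => by rw [h, F_self]⟩
      rw [h, ih, pow_succ', mul_assoc, Function.comp_assoc, ← Function.iterate_succ']
    · intro i _ hi
      refine graphEnergy_eq_zero_of_eqOn fun x hx => ?_
      simp only [Function.comp_apply, Pi.single_apply, Pi.zero_apply]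
      exact if_neg fun h => hi (F_eq_vertex hq hx h).1
    · simp

/-- The energy of `u` against the indicator of the junction point of `F_i SG` and `F_j SG`. -/
lemma graphEnergy_single_junction (hq : AffineIndependent ℝ q) {i j : Fin 3} (hij : i ≠ j)
    (m : ℕ) (u : Plane → ℝ) :
    graphEnergy q (m + 1) u (Pi.single (F q i (q j)) 1) =
      (5 / 3) ^ (m + 1) * (flux q (u ∘ F q i ∘ (F q j)^[m]) j +
        flux q (u ∘ F q j ∘ (F q i)^[m]) i) := by
  obtain ⟨k, hjk, hik⟩ := exists_third i j hij
  have h1 : ∀ i j : Fin 3, (Pi.single (F q i (q j)) (1 : ℝ) : Plane → ℝ) ∘ F q i =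
      Pi.single (q j) 1 := by
    intro i j
    funext x
    simp only [Function.comp_apply, Pi.single_apply, (F_injective q i).eq_iff]
  have h2 : EqOn ((Pi.single (F q i (q j)) (1 : ℝ) : Plane → ℝ) ∘ F q k) 0 (gasket q) := by
    intro x hx
    simp only [Function.comp_apply, Pi.single_apply, Pi.zero_apply]
    refine if_neg fun h => hjk ?_
    exact vertex_injective hq
      (eq_vertex_of_F_eq hq hik (vertex_mem_gasket q j) hx h.symm)
  rw [graphEnergy_succ, sum_eq_of_distinct _ hij hjk hik, graphEnergy_eq_zero_of_eqOn h2, h1,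
    F_comm q i j, h1, graphEnergy_single_vertex hq, graphEnergy_single_vertex hq, pow_succ']
  simp only [Function.comp_assoc]
  ring

lemma junction_not_mem_V0 (hq : AffineIndependent ℝ q) {i j : Fin 3} (hij : i ≠ j) :
    F q i (q j) ∉ V0 q := by
  rintro ⟨k, hk⟩
  obtain ⟨h1, h2⟩ := F_eq_vertex hq (vertex_mem_gasket q j) hk.symm
  exact hij (h1.trans (vertex_injective hq h2).symm)

/-! ### The half gasket as a union of cells -/

/-- The word of the cell `F_0^m F_1 SG`, with boundary points `x_{m+1}, y_m, y_{m+1}`; these cells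
make up the half gasket. -/
def strip (m : ℕ) : List (Fin 3) := List.replicate m 0 ++ [1]

lemma cellMap_strip (q : Fin 3 → Plane) (m : ℕ) (x : Plane) :
    cellMap q (strip m) x = (F q 0)^[m] (F q 1 x) := by
  rw [strip, cellMap_append, cellMap_replicate]; rfl

lemma cellMap_strip_zero (q : Fin 3 → Plane) (m : ℕ) :
    cellMap q (strip m) (q 0) = yPt q (m + 1) := by
  rw [cellMap_strip, F_comm, yPt, Function.iterate_succ_apply]

lemma cellMap_strip_one (q : Fin 3 → Plane) (m : ℕ) :
    cellMap q (strip m) (q 1) = yPt q m := by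
  rw [cellMap_strip, F_self, yPt]

lemma xPt_succ (q : Fin 3 → Plane) (m : ℕ) : xPt q (m + 1) = (F q 0)^[m] (F q 2 (q 1)) := rfl

lemma cellMap_strip_two (q : Fin 3 → Plane) (m : ℕ) :
    cellMap q (strip m) (q 2) = xPt q (m + 1) := by
  rw [cellMap_strip, F_comm, xPt_succ]

lemma exists_isSkewHarmonic (hq : AffineIndependent ℝ q) : ∃ h, IsSkewHarmonic q h := by
  obtain ⟨h, h1, h2, h3⟩ := exists_isHarmonic hq ![0, 1, -1]
  exact ⟨h, isHarmonicExtensionOnCell_iff.2 ⟨h1, h2⟩, h3 0, h3 1, h3 2⟩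

/-- The signs of a skew-symmetric harmonic function on the cells `F_0^n F_1 SG` and
`F_0^n F_2 SG`. -/
lemma IsHarmonic.skew_sign {g : Plane → ℝ} (hg : IsHarmonic q g)
    (hc : ContinuousOn g (gasket q)) {t : ℝ} (ht : 0 < t) (h0 : g (q 0) = 0) (h1 : g (q 1) = t)
    (h2 : g (q 2) = -t) (n : ℕ) {y : Plane} (hy : y ∈ gasket q) :
    (y ≠ q 2 → 0 < g ((F q 0)^[n] (F q 1 y))) ∧ (y ≠ q 1 → g ((F q 0)^[n] (F q 2 y)) < 0) ∧
      g ((F q 0)^[n] (F q 2 (q 1))) = 0 := by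
  have hcF : ∀ j, ContinuousOn (g ∘ F q j) (gasket q) := fun j =>
    hc.comp (continuous_F q j).continuousOn fun _ hx => F_mem_gasket hx j
  have h01 : g (F q 0 (q 1)) = t / 5 := by
    rw [hg.midpointRule 0 1 2 (by decide) (by decide) (by decide), h0, h1, h2]; ring
  have h02 : g (F q 0 (q 2)) = -(t / 5) := by
    rw [hg.midpointRule 0 2 1 (by decide) (by decide) (by decide), h0, h1, h2]; ring
  have h21 : g (F q 2 (q 1)) = 0 := by
    rw [hg.midpointRule 2 1 0 (by decide) (by decide) (by decide), h0, h1, h2]; ring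
  have h12 : g (F q 1 (q 2)) = 0 := by rw [F_comm, h21]
  induction n generalizing g t with
  | zero =>
    refine ⟨fun hne => ?_, fun hne => ?_, h21⟩
    · refine (hg.comp_F 1).pos (hcF 1) h12 (fun i hi => ?_) hy hne
      fin_cases i
      · simp only [Function.comp_apply, Fin.zero_eta, F_comm q 1 0, h01]; positivity
      · simp only [Function.comp_apply, Fin.mk_one, F_self, h1, ht]
      · exact absurd rfl hi
    · have := (hg.comp_F 2).neg.pos (hcF 2).neg (k := 1)
        (by simp only [Function.comp_apply, h21, neg_zero]) (fun i hi => ?_) hy hne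
      · simp only [Function.comp_apply] at this
        simp only [Function.iterate_zero, id_eq]
        linarith
      · fin_cases i
        · simp only [Function.comp_apply, Fin.zero_eta, F_comm q 2 0, h02]
          linarith
        · exact absurd rfl hi
        · simp only [Function.comp_apply, Fin.reduceFinMk, F_self, h2]; linarith
  | succ n ih =>
    have hg' := hg.comp_F 0
    have ht' : 0 < t / 5 := by positivity
    have h0' : (g ∘ F q 0) (q 0) = 0 := by rw [Function.comp_apply, F_self, h0]
    have h := ih hg' (hcF 0) ht' h0' h01 h02
      (fun j => (hcF 0).comp (continuous_F q j).continuousOn fun _ hx => F_mem_gasket hx j)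
      (by rw [hg'.midpointRule 0 1 2 (by decide) (by decide) (by decide), h0', Function.comp_apply,
            h01, Function.comp_apply, h02]; ring)
      (by rw [hg'.midpointRule 0 2 1 (by decide) (by decide) (by decide), h0', Function.comp_apply,
            h02, Function.comp_apply, h01]; ring)
      (by rw [hg'.midpointRule 2 1 0 (by decide) (by decide) (by decide), h0', Function.comp_apply,
            h02, Function.comp_apply, h01]; ring)
      (by rw [hg'.midpointRule 1 2 0 (by decide) (by decide) (by decide), h0', Function.comp_apply,
            h01, Function.comp_apply, h02]; ring)
    simpa only [Function.iterate_succ_apply', Function.comp_apply] using h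

lemma IsSkewHarmonic.sign {h : Plane → ℝ} (hh : IsSkewHarmonic q h) (n : ℕ) {y : Plane}
    (hy : y ∈ gasket q) :
    (y ≠ q 2 → 0 < h ((F q 0)^[n] (F q 1 y))) ∧ (y ≠ q 1 → h ((F q 0)^[n] (F q 2 y)) < 0) ∧
      h ((F q 0)^[n] (F q 2 (q 1))) = 0 := by
  obtain ⟨h1, h2⟩ := isHarmonicExtensionOnCell_iff.1 hh.harmonic
  exact IsHarmonic.skew_sign h2 h1 one_pos hh.value_zero hh.value_one hh.value_two n hy

lemma xPt_not_mem_V0 (hq : AffineIndependent ℝ q) (m : ℕ) : xPt q (m + 1) ∉ V0 q := by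
  rintro ⟨k, hk⟩
  exact junction_not_mem_V0 hq (i := 2) (j := 1) (by decide)
    ⟨k, (iterate_F_eq_vertex hq m (F_mem_gasket (vertex_mem_gasket q 1) 2) hk.symm).symm⟩

lemma cellMap_strip_eq_vertex (hq : AffineIndependent ℝ q) {m : ℕ} {y : Plane}
    (hy : y ∈ gasket q) {k : Fin 3} (h : cellMap q (strip m) y = q k) : k = 1 ∧ y = q 1 := by
  rw [cellMap_strip] at h
  obtain ⟨rfl, h2⟩ := F_eq_vertex hq hy (iterate_F_eq_vertex hq m (F_mem_gasket hy 1) h)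
  exact ⟨rfl, h2⟩

lemma cellMap_strip_mem_Omega (hq : AffineIndependent ℝ q) {m : ℕ} {y : Plane}
    (hy : y ∈ gasket q) (h2 : y ≠ q 2) (h1 : cellMap q (strip m) y ≠ q 1) :
    cellMap q (strip m) y ∈ Omega q := by
  obtain ⟨h, hh⟩ := exists_isSkewHarmonic hq
  refine ⟨⟨cellMap_mem_gasket hy _, ?_⟩, h, hh, ?_⟩
  · rintro ⟨k, hk⟩
    obtain ⟨rfl, -⟩ := cellMap_strip_eq_vertex hq hy hk.symm
    exact h1 hk.symm
  · rw [cellMap_strip]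
    exact (hh.sign m hy).1 h2

lemma iterate_F_two_not_mem_Omega (m : ℕ) {y : Plane} (hy : y ∈ gasket q) :
    (F q 0)^[m] (F q 2 y) ∉ Omega q := by
  rintro ⟨-, h, hh, hpos⟩
  by_cases h1 : y = q 1
  · rw [h1, (hh.sign m hy).2.2] at hpos
    exact lt_irrefl _ hpos
  · exact lt_asymm hpos ((hh.sign m hy).2.1 h1)

lemma xPt_not_mem_Omega (m : ℕ) : xPt q (m + 1) ∉ Omega q :=
  iterate_F_two_not_mem_Omega m (vertex_mem_gasket q 1)

lemma vertex_not_mem_Omega (i : Fin 3) : q i ∉ Omega q := fun h => h.1.2 ⟨i, rfl⟩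

lemma exists_strip_of_mem_Omega {x : Plane} (hx : x ∈ Omega q) : ∃ m, x ∈ cell q (strip m) := by
  obtain rfl | ⟨n, i, hi, y, hy, rfl⟩ := eq_vertex_or_exists_iterate 0 hx.1.1
  · exact absurd hx (vertex_not_mem_Omega 0)
  · fin_cases i
    · exact absurd rfl hi
    · exact ⟨n, y, hy, cellMap_strip q n y⟩
    · exact absurd hx (iterate_F_two_not_mem_Omega n hy)

lemma xPt_mem_X (hq : AffineIndependent ℝ q) (m : ℕ) : xPt q (m + 1) ∈ X q := by
  obtain ⟨h, hh⟩ := exists_isSkewHarmonic hq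
  have h1 := vertex_mem_gasket q 1
  exact ⟨⟨iterate_F_mem_gasket (F_mem_gasket h1 2) 0 m, xPt_not_mem_V0 hq m⟩, h, hh,
    (hh.sign m h1).2.2⟩

lemma exists_eq_xPt_of_mem_X {x : Plane} (hx : x ∈ X q) : ∃ m, x = xPt q (m + 1) := by
  obtain ⟨⟨hxg, hxv⟩, h, hh, h0⟩ := hx
  obtain rfl | ⟨n, i, hi, y, hy, rfl⟩ := eq_vertex_or_exists_iterate 0 hxg
  · exact absurd ⟨0, rfl⟩ hxv
  · fin_cases i
    · exact absurd rfl hi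
    · refine ⟨n, ?_⟩
      by_cases h2 : y = q 2
      · rw [h2, ← cellMap_strip_two, cellMap_strip]; rfl
      · exact absurd h0 ((hh.sign n hy).1 h2).ne'
    · refine ⟨n, ?_⟩
      by_cases h1 : y = q 1
      · rw [h1]; rfl
      · exact absurd h0 ((hh.sign n hy).2.1 h1).ne

/-- The closed half gasket consists of `q_0` and the cells `F_0^m F_1 SG`. -/
lemma closureOmega_eq (hq : AffineIndependent ℝ q) :
    closureOmega q = {q 0} ∪ ⋃ m, cell q (strip m) := by
  ext x
  simp only [closureOmega, boundaryOmega, mem_union, mem_insert_iff, mem_singleton_iff, mem_iUnion]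
  constructor
  · rintro (h | (rfl | rfl) | h)
    · exact Or.inr (exists_strip_of_mem_Omega h)
    · exact Or.inl rfl
    · exact Or.inr ⟨0, q 1, vertex_mem_gasket q 1, cellMap_strip_one q 0⟩
    · obtain ⟨m, rfl⟩ := exists_eq_xPt_of_mem_X h
      exact Or.inr ⟨m, q 2, vertex_mem_gasket q 2, cellMap_strip_two q m⟩
  · rintro (rfl | ⟨m, y, hy, rfl⟩)
    · exact Or.inr (Or.inl (Or.inl rfl))
    · by_cases h1 : cellMap q (strip m) y = q 1
      · exact Or.inr (Or.inl (Or.inr h1))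
      · by_cases h2 : y = q 2
        · rw [h2, cellMap_strip_two]
          exact Or.inr (Or.inr (xPt_mem_X hq m))
        · exact Or.inl (cellMap_strip_mem_Omega hq hy h2 h1)

lemma cell_strip_subset_closureOmega (hq : AffineIndependent ℝ q) (m : ℕ) :
    cell q (strip m) ⊆ closureOmega q := by
  rw [closureOmega_eq hq]
  exact (subset_iUnion (fun m => cell q (strip m)) m).trans subset_union_right

/-- Every cell contained in `Ω` is contained in one of the cells `F_0^m F_1 SG`. -/
lemma exists_strip_prefix {w : List (Fin 3)} (hw : cell q w ⊆ Omega q) :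
    ∃ m v, w = strip m ++ v := by
  have key : ∀ (w : List (Fin 3)) (n : ℕ), cell q (List.replicate n 0 ++ w) ⊆ Omega q →
      ∃ m v, List.replicate n 0 ++ w = strip m ++ v := by
    intro w
    induction w with
    | nil =>
      intro n h
      refine absurd (h ⟨q 0, vertex_mem_gasket q 0, ?_⟩) (vertex_not_mem_Omega 0)
      rw [cellMap_append, cellMap_replicate]
      exact iterate_F_self q 0 n
    | cons i w ih =>
      intro n h
      fin_cases i
      · have e : List.replicate n (0 : Fin 3) ++ 0 :: w = List.replicate (n + 1) 0 ++ w := by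
          rw [List.replicate_succ']; simp
        simp only [Fin.zero_eta] at h ⊢
        rw [e] at h ⊢
        exact ih (n + 1) h
      · exact ⟨n, w, by simp [strip]⟩
      · refine absurd (h ⟨q 0, vertex_mem_gasket q 0, ?_⟩)
          (iterate_F_two_not_mem_Omega n (cellMap_mem_gasket (vertex_mem_gasket q 0) w))
        rw [cellMap_append, cellMap_replicate]
        rfl
  exact key w 0 hw

lemma tendsto_iterate_F (q : Fin 3 → Plane) (j : Fin 3) (x : Plane) :
    Tendsto (fun n => (F q j)^[n] x) atTop (𝓝 (q j)) := by
  rw [tendsto_iff_dist_tendsto_zero]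
  have h : ∀ n, dist ((F q j)^[n] x) (q j) = (1 / 2 : ℝ) ^ n * dist x (q j) := by
    intro n
    have := dist_cellMap q (List.replicate n j) x (q j)
    rwa [cellMap_replicate, iterate_F_self, List.length_replicate] at this
  simp only [h]
  simpa using (tendsto_pow_atTop_nhds_zero_of_lt_one (r := (1 / 2 : ℝ))
      (by norm_num) (by norm_num)).mul_const (dist x (q j))

/-! ### Linear recurrences -/

lemma eq_zero_of_bounded_of_succ_eq_three_mul {e : ℕ → ℝ} {C : ℝ} (hC : ∀ n, |e n| ≤ C)
    (h : ∀ n, e (n + 1) = 3 * e n) (n : ℕ) : e n = 0 := by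
  have h0 : ∀ n, e n = 3 ^ n * e 0 := by
    intro n
    induction n with
    | zero => simp
    | succ n ih => rw [h, ih, pow_succ]; ring
  by_contra hne
  have h1 : e 0 ≠ 0 := fun h2 => hne (by rw [h0, h2, mul_zero])
  obtain ⟨m, hm⟩ := pow_unbounded_of_one_lt (C / |e 0|) (by norm_num : (1 : ℝ) < 3)
  have h2 := hC m
  rw [h0, abs_mul, abs_of_pos (by positivity)] at h2
  rw [div_lt_iff₀ (abs_pos.2 h1)] at hm
  linarith

/-- The recurrence has characteristic roots `3` and `1/5`; boundedness excludes the root `3`. -/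
lemma succ_eq_of_bounded_recurrence {d : ℕ → ℝ} {C : ℝ} (hC : ∀ n, |d n| ≤ C)
    (h : ∀ n, 16 * d (n + 1) = 3 * d n + 5 * d (n + 2)) (n : ℕ) : d (n + 1) = d n / 5 := by
  have key := eq_zero_of_bounded_of_succ_eq_three_mul (e := fun n => d (n + 1) - d n / 5)
    (C := 2 * C) (fun n => ?_) (fun n => ?_) n
  · linarith
  · have h1 := abs_le.1 (hC n)
    have h2 := abs_le.1 (hC (n + 1))
    rw [abs_le]
    constructor <;> linarith
  · have := h n
    linarith

lemma eq_zero_of_bounded_recurrence {d : ℕ → ℝ} {C : ℝ} (hC : ∀ n, |d n| ≤ C) (h0 : d 0 = 0)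
    (h : ∀ n, 16 * d (n + 1) = 3 * d n + 5 * d (n + 2)) (n : ℕ) : d n = 0 := by
  induction n with
  | zero => exact h0
  | succ n ih => rw [succ_eq_of_bounded_recurrence hC h, ih, zero_div]

/-- The vertex values `s n, t n, r n` around a corner at which the function tends to `P`. The sum
`s + t` satisfies a recurrence with characteristic roots `1` and `3/5`, the difference `s - t` one
with roots `3` and `1/5`; the limit eliminates one solution of each. -/
lemma corner_recurrence {s t r : ℕ → ℝ} {P : ℝ} (hs : Tendsto s atTop (𝓝 P))
    (ht : Tendsto t atTop (𝓝 P)) (h1 : ∀ n, 4 * r n = s n + t n + s (n + 1) + t (n + 1))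
    (h2 : ∀ n, (2 * s (n + 1) - s (n + 2) - r (n + 1)) +
      3 / 5 * (2 * s (n + 1) - s n - r n) = 0)
    (h3 : ∀ n, (2 * t (n + 1) - t (n + 2) - r (n + 1)) +
      3 / 5 * (2 * t (n + 1) - t n - r n) = 0) (n : ℕ) :
    s (n + 1) = (2 * P + 2 * s n + t n) / 5 ∧ t (n + 1) = (2 * P + 2 * t n + s n) / 5 ∧
      r n = (2 * s n + 2 * t n + P) / 5 := by
  have hb : ∃ C, ∀ n, |s n - t n| ≤ C := by
    obtain ⟨C, hC⟩ := (hs.sub ht).abs.bddAbove_range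
    exact ⟨C, fun n => hC ⟨n, rfl⟩⟩
  obtain ⟨C, hC⟩ := hb
  have hd := succ_eq_of_bounded_recurrence (d := fun n => s n - t n) hC (fun n => by
    linarith [h2 n, h3 n]) n
  have hconst : ∀ n, 5 * (s (n + 1) + t (n + 1)) - 3 * (s n + t n) =
      5 * (s 1 + t 1) - 3 * (s 0 + t 0) := by
    intro n
    induction n with
    | zero => rfl
    | succ n ih => linarith [h1 n, h1 (n + 1), h2 n, h3 n]
  have hlim : Tendsto (fun n => 5 * (s (n + 1) + t (n + 1)) - 3 * (s n + t n)) atTop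
      (𝓝 (5 * (P + P) - 3 * (P + P))) :=
    ((((tendsto_add_atTop_iff_nat 1).2 hs).add ((tendsto_add_atTop_iff_nat 1).2 ht)).const_mul
      5).sub ((hs.add ht).const_mul 3)
  have hP := tendsto_nhds_unique hlim
    (tendsto_const_nhds.congr fun n => (hconst n).symm)
  have hsum := hconst n
  have := h1 n
  refine ⟨?_, ?_, ?_⟩ <;> linarith

/-! ### The vertex values of the solution -/

lemma abs_le_of_tendsto {a : ℕ → ℝ} {A : ℝ} (ha : Tendsto a atTop (𝓝 A)) :
    ∃ C, ∀ n, |a n| ≤ C := by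
  obtain ⟨C, hC⟩ := ha.abs.bddAbove_range
  exact ⟨C, fun n => hC ⟨n, rfl⟩⟩

lemma summable_geometric_mul {a : ℕ → ℝ} {C : ℝ} (hC : ∀ n, |a n| ≤ C) :
    Summable fun k : ℕ => (1 / 3 : ℝ) ^ k * a k := by
  refine Summable.of_norm_bounded (g := fun k : ℕ => (1 / 3 : ℝ) ^ k * C)
    ((summable_geometric_of_lt_one (by norm_num) (by norm_num)).mul_right C) fun k => ?_
  rw [norm_mul, Real.norm_of_nonneg (by positivity), Real.norm_eq_abs]
  gcongr
  exact hC k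

/-- The sum `∑_{k ≥ 1} 3^{-k} a_{m+k}`, half of a weighted average of the values after `a_m`. -/
noncomputable def tailAverage (a : ℕ → ℝ) (m : ℕ) : ℝ :=
  ∑' k : ℕ, (1 / 3 : ℝ) ^ (k + 1) * a (m + (k + 1))

lemma summable_tailAverage {a : ℕ → ℝ} {C : ℝ} (hC : ∀ n, |a n| ≤ C) (m : ℕ) :
    Summable fun k : ℕ => (1 / 3 : ℝ) ^ (k + 1) * a (m + (k + 1)) :=
  (summable_nat_add_iff 1).2 (summable_geometric_mul (a := fun k => a (m + k)) fun _ => hC _)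

lemma tailAverage_eq {a : ℕ → ℝ} {C : ℝ} (hC : ∀ n, |a n| ≤ C) (m : ℕ) :
    tailAverage a m = 1 / 3 * a (m + 1) +
      ∑' k : ℕ, (1 / 3 : ℝ) ^ (k + 2) * a (m + (k + 2)) := by
  rw [tailAverage, (summable_tailAverage hC m).tsum_eq_zero_add]
  norm_num [add_assoc]

lemma tailAverage_succ {a : ℕ → ℝ} {C : ℝ} (hC : ∀ n, |a n| ≤ C) (m : ℕ) :
    tailAverage a m = (a (m + 1) + tailAverage a (m + 1)) / 3 := by
  rw [tailAverage_eq hC, tailAverage, add_div, div_eq_inv_mul (∑' _, _), ← tsum_mul_left]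
  congr 1
  · ring
  · congr 1
    funext k
    rw [show m + 1 + (k + 1) = m + (k + 2) by ring]
    ring

lemma tendsto_tailAverage {a : ℕ → ℝ} {A : ℝ} (ha : Tendsto a atTop (𝓝 A)) :
    Tendsto (tailAverage a) atTop (𝓝 (A / 2)) := by
  obtain ⟨C, hC⟩ := abs_le_of_tendsto ha
  have hsum : Summable fun k : ℕ => (1 / 3 : ℝ) ^ (k + 1) :=
    (summable_nat_add_iff 1).2 (summable_geometric_of_lt_one (by norm_num) (by norm_num))
  have hval : ∑' k : ℕ, (1 / 3 : ℝ) ^ (k + 1) * A = A / 2 := by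
    simp only [pow_succ]
    rw [tsum_mul_right, tsum_mul_right, tsum_geometric_of_lt_one (by norm_num) (by norm_num)]
    ring
  rw [← hval]
  refine tendsto_tsum_of_dominated_convergence (bound := fun k => (1 / 3 : ℝ) ^ (k + 1) * C)
    (hsum.mul_right C) (fun k => ?_) (Eventually.of_forall fun m k => ?_)
  · exact (ha.comp (tendsto_add_atTop_nat (k + 1))).const_mul _
  · rw [norm_mul, Real.norm_of_nonneg (by positivity), Real.norm_eq_abs]
    gcongr
    exact hC _

lemma sum_Icc_five_pow (a : ℕ → ℝ) (m : ℕ) :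
    (1 / 5 : ℝ) ^ m * ∑ k ∈ Finset.Icc 1 m, (5 : ℝ) ^ k * a k =
      ∑ k ∈ Finset.range m, (1 / 5 : ℝ) ^ k * a (m - k) := by
  induction m with
  | zero => simp
  | succ m ih =>
    have h5 : (1 / 5 : ℝ) ^ m * 5 ^ m = 1 := by rw [← mul_pow]; norm_num
    rw [Finset.sum_Icc_succ_top (by omega), Finset.sum_range_succ', mul_add]
    simp only [Nat.add_sub_add_right, pow_succ, pow_zero, one_mul, Nat.sub_zero]
    have h : ∑ k ∈ Finset.range m, (1 / 5 : ℝ) ^ k * (1 / 5) * a (m - k) =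
        1 / 5 * ∑ k ∈ Finset.range m, (1 / 5 : ℝ) ^ k * a (m - k) := by
      rw [Finset.mul_sum]
      exact Finset.sum_congr rfl fun k _ => by ring
    rw [h, ← ih]
    linear_combination a (m + 1) * h5

lemma tendsto_sum_Icc_five_pow {a : ℕ → ℝ} {A : ℝ} (ha : Tendsto a atTop (𝓝 A)) :
    Tendsto (fun m => (1 / 5 : ℝ) ^ m * ∑ k ∈ Finset.Icc 1 m, (5 : ℝ) ^ k * a k) atTop
      (𝓝 (5 / 4 * A)) := by
  obtain ⟨C, hC⟩ := abs_le_of_tendsto ha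
  have hsum : Summable fun k : ℕ => (1 / 5 : ℝ) ^ k :=
    summable_geometric_of_lt_one (by norm_num) (by norm_num)
  have hval : ∑' k : ℕ, (1 / 5 : ℝ) ^ k * A = 5 / 4 * A := by
    rw [tsum_mul_right, tsum_geometric_of_lt_one (by norm_num) (by norm_num)]
    ring
  have heq : ∀ m, (1 / 5 : ℝ) ^ m * ∑ k ∈ Finset.Icc 1 m, (5 : ℝ) ^ k * a k =
      ∑' k, if k < m then (1 / 5 : ℝ) ^ k * a (m - k) else 0 := by
    intro m
    rw [sum_Icc_five_pow, tsum_eq_sum (s := Finset.range m)]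
    · exact Finset.sum_congr rfl fun k hk => (if_pos (Finset.mem_range.1 hk)).symm
    · intro k hk
      exact if_neg fun h => hk (Finset.mem_range.2 h)
  simp only [heq]
  rw [← hval]
  refine tendsto_tsum_of_dominated_convergence (bound := fun k => (1 / 5 : ℝ) ^ k * C)
    (hsum.mul_right C) (fun k => ?_) (Eventually.of_forall fun m k => ?_)
  · refine ((ha.comp (tendsto_sub_atTop_nat k)).const_mul ((1 / 5 : ℝ) ^ k)).congr' ?_
    filter_upwards [eventually_gt_atTop k] with m hm
    rw [if_pos hm]; rfl
  · split_ifs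
    · rw [norm_mul, Real.norm_of_nonneg (by positivity), Real.norm_eq_abs]
      gcongr
      exact hC _
    · rw [norm_zero]
      exact mul_nonneg (by positivity) ((abs_nonneg _).trans (hC 0))

/-- The explicit vertex values; they satisfy the matching conditions at the points `y_m`, see
`vertexValue_recurrence`. -/
noncomputable def vertexValue (a : ℕ → ℝ) (m : ℕ) : ℝ :=
  (1 / 5 : ℝ) ^ m * (a 0 - 9 / 7 * tailAverage a 0
    + 2 / 7 * ∑ k ∈ Finset.Icc 1 m, (5 : ℝ) ^ k * a k) + 9 / 7 * tailAverage a m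

lemma vertexValue_zero (a : ℕ → ℝ) : vertexValue a 0 = a 0 := by
  simp [vertexValue]

lemma vertexValue_one {a : ℕ → ℝ} {C : ℝ} (hC : ∀ n, |a n| ≤ C) :
    vertexValue a 1 =
      1 / 5 * (a 0 + a 1 + 18 * ∑' k : ℕ, (1 / 3 : ℝ) ^ (k + 2) * a (k + 2)) := by
  have h := tailAverage_succ hC 0
  have h' := tailAverage_eq hC 0
  simp only [zero_add] at h h'
  rw [vertexValue]
  simp only [Finset.Icc_self, Finset.sum_singleton, pow_one]
  linear_combination (-27 / 7) * h + 18 / 5 * h'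

/-- The matching of normal derivatives at `y_{m+1}`. -/
lemma vertexValue_recurrence {a : ℕ → ℝ} {C : ℝ} (hC : ∀ n, |a n| ≤ C) (m : ℕ) :
    16 * vertexValue a (m + 1) = 3 * vertexValue a m + 5 * vertexValue a (m + 2) +
      3 * a (m + 1) + 5 * a (m + 2) := by
  have h1 := tailAverage_succ hC m
  have h2 := tailAverage_succ hC (m + 1)
  have h5 : (1 / 5 : ℝ) ^ m * 5 ^ m = 1 := by rw [← mul_pow]; norm_num
  simp only [vertexValue]
  rw [Finset.sum_Icc_succ_top (by omega : 1 ≤ m + 2), Finset.sum_Icc_succ_top (by omega)]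
  simp only [pow_succ]
  rw [show m + 1 + 1 = m + 2 from rfl] at *
  linear_combination (-27 / 7) * h1 + (135 / 7) * h2 +
    (30 / 7 * a (m + 1) - 10 / 7 * a (m + 2)) * h5

lemma tendsto_vertexValue {a : ℕ → ℝ} {A : ℝ} (ha : Tendsto a atTop (𝓝 A)) :
    Tendsto (vertexValue a) atTop (𝓝 A) := by
  have h0 := (tendsto_pow_atTop_nhds_zero_of_lt_one (r := (1 / 5 : ℝ))
    (by norm_num) (by norm_num)).mul_const (a 0 - 9 / 7 * tailAverage a 0)
  have h := (h0.add ((tendsto_sum_Icc_five_pow ha).const_mul (2 / 7))).add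
    ((tendsto_tailAverage ha).const_mul (9 / 7))
  refine (h.congr fun m => ?_).trans (le_of_eq ?_)
  · rw [vertexValue]; ring
  · congr 1; ring

/-! ### The harmonic extension solves the boundary value problem -/

lemma IsHarmonicExtension.strip_isHarmonic {a b : ℕ → ℝ} {u : Plane → ℝ}
    (hu : IsHarmonicExtension q a b u) (m : ℕ) :
    ContinuousOn (u ∘ cellMap q (strip m)) (gasket q) ∧ IsHarmonic q (u ∘ cellMap q (strip m)) :=
  isHarmonicExtensionOnCell_iff.1 (hu.harmonic (m + 1) (by omega))

lemma IsHarmonicExtension.strip_values {a b : ℕ → ℝ} {u : Plane → ℝ}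
    (hu : IsHarmonicExtension q a b u) (m : ℕ) :
    u (cellMap q (strip m) (q 0)) = b (m + 1) ∧ u (cellMap q (strip m) (q 1)) = b m ∧
      u (cellMap q (strip m) (q 2)) = a (m + 1) := by
  rw [cellMap_strip_zero, cellMap_strip_one, cellMap_strip_two]
  exact ⟨hu.value_y _, hu.value_y _, hu.value_x _ (by omega)⟩

/-- Distinct cells `F_0^m F_1 SG` meet only if they are consecutive, and then in one vertex. -/
lemma cellMap_strip_eq (hq : AffineIndependent ℝ q) {m n : ℕ} (hmn : m < n) {x y : Plane}
    (hx : x ∈ gasket q) (hy : y ∈ gasket q)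
    (h : cellMap q (strip m) x = cellMap q (strip n) y) : n = m + 1 ∧ x = q 0 ∧ y = q 1 := by
  obtain ⟨d, rfl⟩ := Nat.exists_eq_add_of_lt hmn
  rw [cellMap_strip, cellMap_strip, add_assoc, Function.iterate_add_apply] at h
  replace h := (F_injective q 0).iterate m h
  rw [Function.iterate_succ_apply'] at h
  have hz := iterate_F_mem_gasket (F_mem_gasket hy 1) 0 d
  have h1 := eq_vertex_of_F_eq hq (by decide) hx hz h
  have h2 := eq_vertex_of_F_eq hq (by decide) hz hx h.symm
  cases d with
  | zero => exact ⟨rfl, h1, (F_eq_vertex hq hy h2).2⟩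
  | succ d =>
    rw [Function.iterate_succ_apply'] at h2
    exact absurd (F_eq_vertex hq (iterate_F_mem_gasket (F_mem_gasket hy 1) 0 d) h2).1 (by decide)

open Classical in
/-- Off the half gasket the constructed function has the irrelevant value `A`. -/
lemma exists_isHarmonicExtension (hq : AffineIndependent ℝ q) (a b : ℕ → ℝ) (A : ℝ) :
    ∃ u, IsHarmonicExtension q a b u ∧ u (q 0) = A := by
  choose H hHc hHh hHv using fun m => exists_isHarmonic hq ![b (m + 1), b m, a (m + 1)]
  have hcompat : ∀ m n x y, x ∈ gasket q → y ∈ gasket q →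
      cellMap q (strip m) x = cellMap q (strip n) y → H m x = H n y := by
    have hlt : ∀ m n x y, m < n → x ∈ gasket q → y ∈ gasket q →
        cellMap q (strip m) x = cellMap q (strip n) y → H m x = H n y := by
      intro m n x y hmn hx hy h
      obtain ⟨rfl, rfl, rfl⟩ := cellMap_strip_eq hq hmn hx hy h
      rw [hHv, hHv]
      rfl
    intro m n x y hx hy h
    obtain hmn | rfl | hmn := lt_trichotomy m n
    · exact hlt m n x y hmn hx hy h
    · rw [cellMap_injective q _ h]
    · exact (hlt n m y x hmn hy hx h.symm).symm
  let u : Plane → ℝ := fun x =>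
    if h : ∃ m, ∃ y ∈ gasket q, cellMap q (strip m) y = x then H h.choose h.choose_spec.choose
    else A
  have hu : ∀ m, ∀ y ∈ gasket q, u (cellMap q (strip m) y) = H m y := by
    intro m y hy
    have h : ∃ n, ∃ z ∈ gasket q, cellMap q (strip n) z = cellMap q (strip m) y :=
      ⟨m, y, hy, rfl⟩
    have h1 := h.choose_spec.choose_spec
    exact (dif_pos h).trans (hcompat _ _ _ _ h1.1 hy h1.2)
  refine ⟨u, ⟨?_, ?_, ?_⟩, ?_⟩
  · intro m hm
    obtain ⟨m, rfl⟩ := Nat.exists_eq_add_of_le' hm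
    exact isHarmonicExtensionOnCell_iff.2 ⟨(hHc m).congr (hu m),
      (hHh m).congr fun x hx => (hu m x hx).symm⟩
  · intro m hm
    obtain ⟨m, rfl⟩ := Nat.exists_eq_add_of_le' hm
    rw [← cellMap_strip_two, hu m _ (vertex_mem_gasket q 2), hHv]
    rfl
  · intro m
    rw [← cellMap_strip_one, hu m _ (vertex_mem_gasket q 1), hHv]
    rfl
  · refine dif_neg ?_
    rintro ⟨m, y, hy, h⟩
    exact absurd (cellMap_strip_eq_vertex hq hy h).1 (by decide)

lemma cell_strip_subset (q : Fin 3 → Plane) {m n : ℕ} (h : m ≤ n) :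
    cell q (strip n) ⊆ cell q (List.replicate m 0) := by
  obtain ⟨d, rfl⟩ := Nat.exists_eq_add_of_le h
  rw [strip, List.replicate_add, List.append_assoc]
  exact cell_append_subset q _ _

lemma vertex_zero_not_mem_strip (hq : AffineIndependent ℝ q) (m : ℕ) :
    q 0 ∉ cell q (strip m) := by
  rintro ⟨y, hy, h⟩
  exact absurd (cellMap_strip_eq_vertex hq hy h).1 (by decide)

lemma isClosed_iUnion_strip (q : Fin 3 → Plane) (N : ℕ) :
    IsClosed (⋃ m : Fin N, cell q (strip m)) :=
  isClosed_iUnion_of_finite fun _ => (isCompact_cell q _).isClosed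

lemma exists_not_mem_cell_replicate {x : Plane} (hx : x ≠ q 0) :
    ∃ N, x ∉ cell q (List.replicate N 0) := by
  obtain ⟨C, hC⟩ := (isCompact_gasket q).isBounded.subset_closedBall (q 0)
  have hlim : Tendsto (fun n : ℕ => (1 / 2 : ℝ) ^ n * C) atTop (𝓝 0) := by
    simpa using (tendsto_pow_atTop_nhds_zero_of_lt_one (r := (1 / 2 : ℝ))
      (by norm_num) (by norm_num)).mul_const C
  obtain ⟨N, hN⟩ := (hlim.eventually (gt_mem_nhds (dist_pos.2 hx))).exists
  refine ⟨N, ?_⟩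
  rintro ⟨y, hy, rfl⟩
  have h := dist_cellMap q (List.replicate N 0) y (q 0)
  rw [cellMap_replicate, iterate_F_self, List.length_replicate, ← cellMap_replicate] at h
  rw [h] at hN
  have h1 : dist y (q 0) ≤ C := hC hy
  have h2 : (1 / 2 : ℝ) ^ N * dist y (q 0) ≤ (1 / 2 : ℝ) ^ N * C := by gcongr
  linarith

/-- Off `q_0` the cells `F_0^m F_1 SG` form a locally finite closed cover; at `q_0` the
maximum principle bounds the extension by its vertex values, which converge. -/
lemma IsHarmonicExtension.continuousOn (hq : AffineIndependent ℝ q) {a b : ℕ → ℝ} {A : ℝ}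
    (ha : Tendsto a atTop (𝓝 A)) (hb : Tendsto b atTop (𝓝 A)) {u : Plane → ℝ}
    (hu : IsHarmonicExtension q a b u) (h0 : u (q 0) = A) :
    ContinuousOn u (closureOmega q) := by
  have hcell : ∀ m, ContinuousOn u (cell q (strip m)) := fun m =>
    (hu.harmonic (m + 1) (by omega)).continuousOn
  intro x hx
  rw [closureOmega_eq hq] at hx ⊢
  by_cases hx0 : x = q 0
  · subst hx0
    rw [Metric.continuousWithinAt_iff']
    intro ε hε
    have hε2 : 0 < ε / 2 := by positivity
    obtain ⟨N, hN⟩ := eventually_atTop.1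
      ((Metric.tendsto_nhds.1 ha _ hε2).and (Metric.tendsto_nhds.1 hb _ hε2))
    have hnhds : (⋃ m : Fin N, cell q (strip m))ᶜ ∈ 𝓝 (q 0) := by
      refine (isClosed_iUnion_strip q N).isOpen_compl.mem_nhds ?_
      simp only [mem_compl_iff, mem_iUnion, not_exists]
      exact fun m => vertex_zero_not_mem_strip hq m
    filter_upwards [mem_nhdsWithin_of_mem_nhds hnhds, self_mem_nhdsWithin] with y hy1 hy2
    rw [h0]
    rcases hy2 with rfl | hy2
    · rw [h0, dist_self]; exact hε
    · obtain ⟨m, z, hz, rfl⟩ := mem_iUnion.1 hy2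
      have hm : N ≤ m := by
        by_contra hlt
        exact hy1 (mem_iUnion.2 ⟨⟨m, not_le.1 hlt⟩, z, hz, rfl⟩)
      have h1 := hN m hm
      have h2 := hN (m + 1) (by omega)
      simp only [Real.dist_eq, abs_lt] at h1 h2
      obtain ⟨hc, hh⟩ := hu.strip_isHarmonic m
      obtain ⟨hv0, hv1, hv2⟩ := hu.strip_values m
      have hup := hh.le_of_vertices_le hc (M := A + ε / 2) (fun i => by
        fin_cases i <;> simp only [Function.comp_apply, Fin.zero_eta, Fin.mk_one, Fin.reduceFinMk,
          hv0, hv1, hv2] <;> linarith) hz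
      have hlo := hh.le_of_le_vertices hc (M := A - ε / 2) (fun i => by
        fin_cases i <;> simp only [Function.comp_apply, Fin.zero_eta, Fin.mk_one, Fin.reduceFinMk,
          hv0, hv1, hv2] <;> linarith) hz
      simp only [Function.comp_apply] at hup hlo
      rw [Real.dist_eq, abs_lt]
      constructor <;> linarith
  · obtain ⟨N, hN⟩ := exists_not_mem_cell_replicate hx0
    have hsub : ({q 0} ∪ ⋃ m, cell q (strip m)) ∩ (cell q (List.replicate N 0))ᶜ ⊆
        ⋃ m : Fin N, cell q (strip m) := by
      rintro y ⟨rfl | hy, hyN⟩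
      · refine absurd ⟨q 0, vertex_mem_gasket q 0, ?_⟩ hyN
        rw [cellMap_replicate, iterate_F_self]
      · obtain ⟨m, hm⟩ := mem_iUnion.1 hy
        have hlt : m < N := by
          by_contra hle
          exact hyN (cell_strip_subset q (not_lt.1 hle) hm)
        exact mem_iUnion.2 ⟨⟨m, hlt⟩, hm⟩
    have hc : ContinuousOn u (⋃ m : Fin N, cell q (strip m)) :=
      LocallyFinite.continuousOn_iUnion (locallyFinite_of_finite _)
        (fun _ => (isCompact_cell q _).isClosed) fun m => hcell m
    have hopen : (cell q (List.replicate N 0))ᶜ ∈ 𝓝 x :=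
      (isCompact_cell q _).isClosed.isOpen_compl.mem_nhds hN
    have h1 := (hc x (hsub ⟨hx, hN⟩)).mono hsub
    rwa [continuousWithinAt_inter hopen] at h1

/-- If `v` vanishes on the cells `F_0^k F_2 SG` and `u` is harmonic on the cells `F_0^k F_1 SG`,
then only the latter and the cell of level `m` at `q_0` contribute to the energy. -/
lemma graphEnergy_strip (m : ℕ) {u v : Plane → ℝ}
    (hu : ∀ k, IsHarmonic q (u ∘ cellMap q (strip k)))
    (hv : ∀ k, ∀ x ∈ gasket q, v ((F q 0)^[k] (F q 2 x)) = 0) :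
    graphEnergy q m u v =
      ∑ k ∈ Finset.range m, (5 / 3 : ℝ) ^ (k + 1) *
        graphEnergy q 0 (u ∘ cellMap q (strip k)) (v ∘ cellMap q (strip k)) +
      (5 / 3 : ℝ) ^ m * graphEnergy q 0 (u ∘ (F q 0)^[m]) (v ∘ (F q 0)^[m]) := by
  induction m generalizing u v with
  | zero => simp
  | succ m ih =>
    have h0 := ih (u := u ∘ F q 0) (v := v ∘ F q 0) (fun k => hu (k + 1)) (fun k x hx => by
      have := hv (k + 1) x hx
      rwa [Function.iterate_succ_apply'] at this)
    have h1 : graphEnergy q m (u ∘ F q 1) (v ∘ F q 1) = graphEnergy q 0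
        (u ∘ cellMap q (strip 0)) (v ∘ cellMap q (strip 0)) := (hu 0).graphEnergy_eq _ m
    have h2 : graphEnergy q m (u ∘ F q 2) (v ∘ F q 2) = 0 :=
      graphEnergy_eq_zero_of_eqOn fun x hx => hv 0 x hx
    rw [graphEnergy_succ, Fin.sum_univ_three, h0, h1, h2, Finset.sum_range_succ', add_zero,
      mul_add, mul_add, Finset.mul_sum, Function.iterate_succ']
    have h3 : ∀ k ∈ Finset.range m, 5 / 3 * ((5 / 3 : ℝ) ^ (k + 1) *
        graphEnergy q 0 ((u ∘ F q 0) ∘ cellMap q (strip k)) ((v ∘ F q 0) ∘ cellMap q (strip k))) =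
        (5 / 3 : ℝ) ^ (k + 1 + 1) * graphEnergy q 0 (u ∘ cellMap q (strip (k + 1)))
          (v ∘ cellMap q (strip (k + 1))) := by
      intro k _
      rw [pow_succ _ (k + 1)]
      simp only [Function.comp_assoc]
      have : cellMap q (strip (k + 1)) = F q 0 ∘ cellMap q (strip k) := rfl
      rw [this]
      ring
    rw [Finset.sum_congr rfl h3, pow_succ]
    simp only [Function.comp_assoc]
    ring

/-- The energies of the cells `F_0^k F_1 SG` telescope by the matching conditions. -/
lemma graphEnergy_strip_sum {a b : ℕ → ℝ}
    (hrec : ∀ m, 16 * b (m + 1) = 3 * b m + 5 * b (m + 2) + 3 * a (m + 1) + 5 * a (m + 2))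
    {u v : Plane → ℝ} (hu : IsHarmonicExtension q a b u)
    (hv : ∀ x ∈ gasket q, x ∉ Omega q → v x = 0) (m : ℕ) :
    ∑ k ∈ Finset.range (m + 1), (5 / 3 : ℝ) ^ (k + 1) *
        graphEnergy q 0 (u ∘ cellMap q (strip k)) (v ∘ cellMap q (strip k)) =
      (5 / 3 : ℝ) ^ (m + 1) * (v (yPt q (m + 1)) * (2 * b (m + 1) - b m - a (m + 1))) := by
  have he : ∀ k, graphEnergy q 0 (u ∘ cellMap q (strip k)) (v ∘ cellMap q (strip k)) =
      v (yPt q (k + 1)) * (2 * b (k + 1) - b k - a (k + 1)) +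
        v (yPt q k) * (2 * b k - b (k + 1) - a (k + 1)) := by
    intro k
    have hx : v (xPt q (k + 1)) = 0 := hv _
      (iterate_F_mem_gasket (F_mem_gasket (vertex_mem_gasket q 1) 2) 0 k) (xPt_not_mem_Omega k)
    simp only [graphEnergy_zero, Fin.sum_univ_three, Function.comp_apply, zero_add,
      show (1 + 1 : Fin 3) = 2 from rfl, show (2 + 1 : Fin 3) = 0 from rfl, cellMap_strip_zero,
      cellMap_strip_one, cellMap_strip_two, hx, hu.value_y, hu.value_x (k + 1) (by omega)]
    ring
  have hy0 : v (yPt q 0) = 0 := hv _ (vertex_mem_gasket q 1) (vertex_not_mem_Omega 1)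
  induction m with
  | zero => rw [Finset.sum_range_one, he, hy0]; ring
  | succ m ih =>
    rw [Finset.sum_range_succ, ih, he]
    simp only [pow_succ]
    linear_combination (5 / 9 * (5 / 3 : ℝ) ^ m * v (yPt q (m + 1))) * hrec m

/-- The energy against a test function `v` vanishes from some level on: `v` vanishes near `q_0`, and
what remains is the telescoped sum, a multiple of `v (y_m) = 0`. -/
lemma IsHarmonicExtension.solvesBVP {a b : ℕ → ℝ}
    (h0 : b 0 = a 0)
    (hrec : ∀ m, 16 * b (m + 1) = 3 * b m + 5 * b (m + 2) + 3 * a (m + 1) + 5 * a (m + 2))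
    {u : Plane → ℝ} (hu : IsHarmonicExtension q a b u)
    (hc : ContinuousOn u (closureOmega q)) : SolvesBVP q a u := by
  refine ⟨⟨hc.mono subset_union_left, continuousOn_const, ?_, ?_⟩, (hu.value_y 0).trans h0,
    hu.value_x⟩
  · intro w hw
    obtain ⟨m, v, rfl⟩ := exists_strip_prefix hw
    refine hasFiniteEnergy_of_piecewise_harmonic 0 fun w' hw' => ?_
    have h := ((hu.strip_isHarmonic m).2.comp_cellMap v).comp_cellMap w'
    refine h.congr fun x _ => ?_
    simp only [Function.comp_apply, cellMap_append]
  · intro v hv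
    obtain ⟨K, hKΩ, hK, hvK⟩ := hv.compactSupport
    have hvΩ : ∀ x ∈ gasket q, x ∉ Omega q → v x = 0 := fun x hx hxΩ =>
      hvK x hx fun h => hxΩ (hKΩ h)
    have hy : ∀ᶠ m in atTop, v (yPt q m) = 0 := by
      have h1 : Kᶜ ∈ 𝓝 (q 0) := hK.isClosed.isOpen_compl.mem_nhds
        fun h => vertex_not_mem_Omega 0 (hKΩ h)
      filter_upwards [(tendsto_iterate_F q 0 (q 1)).eventually h1] with m hm
      exact hvK _ (iterate_F_mem_gasket (vertex_mem_gasket q 1) 0 m) hm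
    simp only [Pi.zero_apply, zero_mul, integral_zero, neg_zero]
    refine tendsto_const_nhds.congr' ?_
    filter_upwards [hy, eventually_ge_atTop 1] with m hm hm1
    obtain ⟨m, rfl⟩ := Nat.exists_eq_add_of_le' hm1
    have h2 : v ((F q 0)^[m + 1] (q 2)) = 0 := by
      refine hvΩ _ (iterate_F_mem_gasket (vertex_mem_gasket q 2) 0 _) ?_
      rw [Function.iterate_succ_apply, F_comm]
      exact iterate_F_two_not_mem_Omega m (vertex_mem_gasket q 0)
    have h3 : v ((F q 0)^[m + 1] (q 0)) = 0 := by
      rw [iterate_F_self]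
      exact hvΩ _ (vertex_mem_gasket q 0) (vertex_not_mem_Omega 0)
    rw [graphEnergy_strip (m + 1) (fun k => (hu.strip_isHarmonic k).2) (fun k x hx =>
        hvΩ _ (iterate_F_mem_gasket (F_mem_gasket hx 2) 0 k) (iterate_F_two_not_mem_Omega k hx)),
      graphEnergy_strip_sum hrec hu hvΩ, hm, graphEnergy_zero, Fin.sum_univ_three]
    rw [yPt] at hm
    simp only [Function.comp_apply, zero_add, show (1 + 1 : Fin 3) = 2 from rfl,
      show (2 + 1 : Fin 3) = 0 from rfl, hm, h2, h3]
    ring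

/-! ### Weak solutions are harmonic on cells -/

/-- A weak solution is orthogonal in the discrete energy of level `n` to every `f` whose vertices of
level `n` in its support only belong to cells contained in `Ω`: the piecewise harmonic
function with the vertex values of `f` is a test function. -/
lemma HasLaplacianOn.graphEnergy_eq_zero (hq : AffineIndependent ℝ q) {W : Plane → ℝ}
    (hW : HasLaplacianOn q (Omega q) W 0) (n : ℕ) (f : Plane → ℝ)
    (hf : ∀ w : List (Fin 3), w.length = n →
      (∀ i, f (cellMap q w (q i)) = 0) ∨ cell q w ⊆ Omega q) :
    graphEnergy q n W f = 0 := by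
  obtain ⟨h, hc, hh⟩ := exists_piecewise_harmonic hq n f
  have htest : IsTestFunction q (Omega q) h := by
    refine ⟨hc, hasFiniteEnergy_of_piecewise_harmonic n fun w hw => (hh w hw).1,
      ⋃ w ∈ {w : List (Fin 3) | w.length = n ∧ cell q w ⊆ Omega q}, cell q w, ?_, ?_, ?_⟩
    · exact iUnion₂_subset fun w hw => hw.2
    · exact ((List.finite_length_eq (Fin 3) n).subset fun w hw => hw.1).isCompact_biUnion
        fun w _ => isCompact_cell q w
    · intro x hx hxK
      obtain ⟨w, hw, y, hy, rfl⟩ := exists_eq_cellMap n hx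
      have hwΩ : ¬ cell q w ⊆ Omega q := fun hw' =>
        hxK (mem_biUnion (show w ∈ {w : List (Fin 3) | w.length = n ∧ cell q w ⊆ Omega q} from
          ⟨hw, hw'⟩) ⟨y, hy, rfl⟩)
      have h0 := (hf w hw).resolve_right hwΩ
      obtain ⟨h1, h2⟩ := hh w hw
      have hcw : ContinuousOn (h ∘ cellMap q w) (gasket q) :=
        hc.comp (continuous_cellMap q w).continuousOn fun _ hx => cellMap_mem_gasket hx w
      have h3 : ∀ i, (h ∘ cellMap q w) (q i) = 0 := fun i => (h2 i).trans (h0 i)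
      exact le_antisymm (h1.le_of_vertices_le hcw (fun i => (h3 i).le) hy)
        (h1.le_of_le_vertices hcw (fun i => (h3 i).ge) hy)
  have hlim := hW.weak h htest
  simp only [Pi.zero_apply, zero_mul, integral_zero, neg_zero] at hlim
  have hconst : Tendsto (fun m => graphEnergy q m W h) atTop (𝓝 (graphEnergy q n W h)) := by
    refine tendsto_const_nhds.congr' ?_
    filter_upwards [eventually_ge_atTop n] with m hm
    obtain ⟨k, rfl⟩ := Nat.exists_eq_add_of_le hm
    rw [graphEnergy_comm, graphEnergy_comm q (n + k)]
    exact (graphEnergy_piecewise_harmonic n k (fun w hw => (hh w hw).1) W).symm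
  have heq : graphEnergy q n W h = graphEnergy q n W f := by
    unfold graphEnergy
    simp only [(hh _ List.length_ofFn).2]
  rw [← heq]
  exact tendsto_nhds_unique hconst hlim

lemma eq_of_mem_of_cellMap_eq_vertex (hq : AffineIndependent ℝ q) {i : Fin 3}
    {w : List (Fin 3)} {y : Plane} (hy : y ∈ gasket q) (h : cellMap q w y = q i) :
    ∀ a ∈ w, a = i := by
  induction w with
  | nil => simp
  | cons b w ih =>
    obtain ⟨h1, h2⟩ := F_eq_vertex hq (cellMap_mem_gasket hy w) h
    intro a ha
    rcases List.mem_cons.1 ha with rfl | ha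
    · exact h1
    · exact ih h2 a ha

/-- Among the cells of level `w.length + k + 1`, only `F_w F_i F_j^k SG` and `F_w F_j F_i^k SG` have
the junction point `F_w F_i q_j` as a vertex. -/
lemma eq_or_eq_of_cellMap_eq_junction (hq : AffineIndependent ℝ q) {i j l : Fin 3}
    (hij : i ≠ j) {k : ℕ} {w w' : List (Fin 3)} (hlen : w'.length = w.length + (k + 1))
    (h : cellMap q w' (q l) = cellMap q w (F q i (q j))) :
    w' = w ++ i :: List.replicate k j ∨ w' = w ++ j :: List.replicate k i := by
  have hrep : ∀ (v : List (Fin 3)) (j : Fin 3), v.length = k → cellMap q v (q l) = q j →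
      v = List.replicate k j := fun v j hv h =>
    List.eq_replicate_iff.2 ⟨hv, eq_of_mem_of_cellMap_eq_vertex hq (vertex_mem_gasket q l) h⟩
  induction w generalizing w' with
  | nil =>
    cases w' with
    | nil => simp at hlen
    | cons a v =>
      have hv : v.length = k := by simpa using hlen
      have hvg := cellMap_mem_gasket (vertex_mem_gasket q l) v
      have hj := vertex_mem_gasket q j
      change F q a (cellMap q v (q l)) = F q i (q j) at h
      by_cases ha : a = i
      · subst ha
        left
        rw [hrep v j hv (F_injective q a h)]
        rfl
      · right
        have h1 := vertex_injective hq (eq_vertex_of_F_eq hq (Ne.symm ha) hj hvg h.symm)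
        rw [hrep v i hv (eq_vertex_of_F_eq hq ha hvg hj h), h1]
        rfl
  | cons b w ih =>
    cases w' with
    | nil => simp at hlen
    | cons a v =>
      have hvg := cellMap_mem_gasket (vertex_mem_gasket q l) v
      have hp := F_mem_gasket (vertex_mem_gasket q j) i
      change F q a (cellMap q v (q l)) = F q b (cellMap q w (F q i (q j))) at h
      by_cases hab : a = b
      · subst hab
        have := ih (w' := v) (by simp at hlen; omega) (F_injective q a h)
        simpa using this
      · have h1 := eq_vertex_of_F_eq hq (Ne.symm hab) (cellMap_mem_gasket hp w) hvg h.symm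
        exact absurd ⟨a, (cellMap_eq_vertex hq w hp h1).symm⟩ (junction_not_mem_V0 hq hij)

/-- The normal derivatives of a weak solution match at each junction point, provided that the two
cells of the level in question around it lie in `Ω`. -/
lemma HasLaplacianOn.flux_add_flux (hq : AffineIndependent ℝ q) {W : Plane → ℝ}
    (hW : HasLaplacianOn q (Omega q) W 0) (w : List (Fin 3)) {i j : Fin 3} (hij : i ≠ j) (k : ℕ)
    (h1 : cell q (w ++ i :: List.replicate k j) ⊆ Omega q)
    (h2 : cell q (w ++ j :: List.replicate k i) ⊆ Omega q) :
    flux q (W ∘ cellMap q (w ++ i :: List.replicate k j)) j +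
      flux q (W ∘ cellMap q (w ++ j :: List.replicate k i)) i = 0 := by
  have hzero := hW.graphEnergy_eq_zero hq (w.length + (k + 1))
    (Pi.single (cellMap q w (F q i (q j))) 1) fun w' hw' => by
      by_cases h : cell q w' ⊆ Omega q
      · exact Or.inr h
      · left
        intro l
        rw [Pi.single_apply]
        refine if_neg fun he => h ?_
        rcases eq_or_eq_of_cellMap_eq_junction hq hij hw' he with rfl | rfl
        · exact h1
        · exact h2
  rw [graphEnergy_localize hq w (F_mem_gasket (vertex_mem_gasket q j) i)
    (junction_not_mem_V0 hq hij), graphEnergy_single_junction hq hij] at hzero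
  have hcell : ∀ i j : Fin 3, W ∘ cellMap q (w ++ i :: List.replicate k j) =
      (W ∘ cellMap q w) ∘ F q i ∘ (F q j)^[k] := by
    intro i j
    funext x
    simp only [Function.comp_apply, cellMap_append, cellMap, cellMap_replicate]
  rw [hcell, hcell]
  have hpos : (5 / 3 : ℝ) ^ w.length * (5 / 3) ^ (k + 1) ≠ 0 := by positivity
  rw [← mul_assoc] at hzero
  exact (mul_eq_zero.1 hzero).resolve_left hpos

lemma midpointRule_of_flux {g : Plane → ℝ}
    (h : ∀ i j, i ≠ j → flux q (g ∘ F q i) j + flux q (g ∘ F q j) i = 0) : MidpointRule q g := by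
  intro i j k hij hjk hik
  have h1 := h i j hij
  have h2 := h j k hjk
  have h3 := h i k hik
  rw [flux_eq _ hij.symm hik hjk, flux_eq _ hij hjk hik] at h1
  rw [flux_eq _ hjk.symm hij.symm hik.symm, flux_eq _ hjk hik.symm hij.symm] at h2
  rw [flux_eq _ hik.symm hij hjk.symm, flux_eq _ hik hjk.symm hij] at h3
  simp only [Function.comp_apply, F_self, F_comm q j i, F_comm q k i, F_comm q k j] at h1 h2 h3
  linarith

/-- On cells contained in `Ω` a weak solution obeys the harmonic extension rule. -/
lemma HasLaplacianOn.midpointRule (hq : AffineIndependent ℝ q) {W : Plane → ℝ}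
    (hW : HasLaplacianOn q (Omega q) W 0) {w : List (Fin 3)} (hw : cell q w ⊆ Omega q) :
    MidpointRule q (W ∘ cellMap q w) := by
  refine midpointRule_of_flux fun i j hij => ?_
  have h := hW.flux_add_flux hq w hij 0 ((cell_append_subset q w _).trans hw)
    ((cell_append_subset q w _).trans hw)
  have hcell : ∀ i j : Fin 3, W ∘ cellMap q (w ++ i :: List.replicate 0 j) =
      (W ∘ cellMap q w) ∘ F q i := by
    intro i j
    funext x
    simp only [Function.comp_apply, cellMap_append]
    rfl
  rwa [hcell, hcell] at h

lemma cell_append_subset_Omega_of_corner (hq : AffineIndependent ℝ q) {w : List (Fin 3)}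
    {i : Fin 3} (hΩ : ∀ y ∈ gasket q, y ≠ q i → cellMap q w y ∈ Omega q) {v : List (Fin 3)}
    {a : Fin 3} (ha : a ∈ v) (hai : a ≠ i) : cell q (w ++ v) ⊆ Omega q := by
  rintro _ ⟨y, hy, rfl⟩
  rw [cellMap_append]
  exact hΩ _ (cellMap_mem_gasket hy v) fun h =>
    hai (eq_of_mem_of_cellMap_eq_vertex hq hy h a ha)

/-- A weak solution on a cell, all of whose points except possibly the corner `F_w q_i` lie in `Ω`,
obeys the harmonic extension rule on all subcells at this corner, if it is continuous there. Test
functions cannot be supported at the corner; the rule there comes from continuity, through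
`corner_recurrence`. -/
lemma HasLaplacianOn.midpointRule_corner (hq : AffineIndependent ℝ q) {W : Plane → ℝ}
    (hW : HasLaplacianOn q (Omega q) W 0) {w : List (Fin 3)} {i : Fin 3}
    (hΩ : ∀ y ∈ gasket q, y ≠ q i → cellMap q w y ∈ Omega q)
    (hc : ContinuousOn (W ∘ cellMap q w) (gasket q)) (n : ℕ) :
    MidpointRule q (W ∘ cellMap q (w ++ List.replicate n i)) := by
  obtain ⟨g, hg⟩ : ∃ g, g = W ∘ cellMap q w := ⟨_, rfl⟩
  have hcell : ∀ (n : ℕ) (v : List (Fin 3)) (x : Plane),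
      (W ∘ cellMap q ((w ++ List.replicate n i) ++ v)) x = g ((F q i)^[n] (cellMap q v x)) := by
    intro n v x
    simp only [hg, Function.comp_apply, cellMap_append, cellMap_replicate]
  have hsub : ∀ (n : ℕ) (v : List (Fin 3)) (a : Fin 3), a ∈ v → a ≠ i →
      cell q ((w ++ List.replicate n i) ++ v) ⊆ Omega q := by
    intro n v a ha hai
    rw [List.append_assoc]
    exact cell_append_subset_Omega_of_corner hq hΩ (List.mem_append_right _ ha) hai
  have hmid : ∀ j k, i ≠ j → j ≠ k → i ≠ k → ∀ n, 4 * g ((F q i)^[n] (F q j (q k))) =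
      g ((F q i)^[n] (q j)) + g ((F q i)^[n] (q k)) + g ((F q i)^[n + 1] (q j)) +
        g ((F q i)^[n + 1] (q k)) := by
    intro j k hij hjk hik n
    have h := hW.flux_add_flux hq (w ++ List.replicate n i) hjk 0
      (hsub n _ j (by simp) hij.symm) (hsub n _ k (by simp) hik.symm)
    rw [flux_eq _ hjk.symm hij.symm hik.symm, flux_eq _ hjk hik.symm hij.symm] at h
    simp only [List.replicate_zero, hcell, cellMap, F_self, F_comm q k j, F_comm q j i,
      F_comm q k i, ← Function.iterate_succ_apply] at h
    linarith
  have hedge : ∀ j k, i ≠ j → j ≠ k → i ≠ k → ∀ n,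
      (2 * g ((F q i)^[n + 1] (q j)) - g ((F q i)^[n + 2] (q j)) -
        g ((F q i)^[n + 1] (F q j (q k)))) +
      3 / 5 * (2 * g ((F q i)^[n + 1] (q j)) - g ((F q i)^[n] (q j)) -
        g ((F q i)^[n] (F q j (q k)))) = 0 := by
    intro j k hij hjk hik n
    have h := hW.flux_add_flux hq (w ++ List.replicate n i) hij 1
      (hsub n _ j (by simp) hij.symm) (hsub n _ j (by simp) hij.symm)
    have hrule := (hW.midpointRule hq (hsub n [j] j (by simp) hij.symm)).flux_comp_F i
    have heq : (W ∘ cellMap q ((w ++ List.replicate n i) ++ [j])) ∘ F q i =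
        W ∘ cellMap q ((w ++ List.replicate n i) ++ j :: List.replicate 1 i) := by
      funext x
      simp only [Function.comp_apply, cellMap_append]
      rfl
    rw [heq] at hrule
    rw [hrule, flux_eq _ hij.symm hik hjk, flux_eq _ hij hjk hik] at h
    simp only [List.replicate_one, hcell, cellMap, F_self, F_comm q j i,
      ← Function.iterate_succ_apply] at h
    linarith
  obtain ⟨j, k, hij, hjk, hik⟩ : ∃ j k : Fin 3, i ≠ j ∧ j ≠ k ∧ i ≠ k := by
    clear * -
    revert i; decide
  have hlim : ∀ j, Tendsto (fun n => g ((F q i)^[n] (q j))) atTop (𝓝 (g (q i))) := by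
    intro j
    have h1 : ContinuousWithinAt g (gasket q) (q i) := by
      rw [hg]; exact hc _ (vertex_mem_gasket q i)
    exact h1.tendsto.comp (tendsto_nhdsWithin_iff.2 ⟨tendsto_iterate_F q i (q j),
      Eventually.of_forall fun n => iterate_F_mem_gasket (vertex_mem_gasket q j) i n⟩)
  obtain ⟨h1, h2, h3⟩ := corner_recurrence (hlim j) (hlim k)
    (hmid j k hij hjk hik) (hedge j k hij hjk hik)
    (by simpa only [F_comm q k j] using hedge k j hik hjk.symm hij) n
  simp only [Function.iterate_succ_apply] at h1 h2
  have hcell0 : ∀ x, (W ∘ cellMap q (w ++ List.replicate n i)) x = g ((F q i)^[n] x) := by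
    intro x
    have := hcell n [] x
    rwa [List.append_nil] at this
  have hi : (F q i)^[n] (q i) = q i := iterate_F_self q i n
  refine midpointRule_of_apply_F fun a b => ?_
  rw [hcell0, subcellValues, sum_eq_of_distinct _ hij hjk hik]
  simp only [Function.comp_apply (g := q), hcell0, hi]
  have hthree : ∀ a : Fin 3, a = i ∨ a = j ∨ a = k := by
    clear * - hij hjk hik
    revert i j k; decide
  have hji := F_comm q j i
  have hki := F_comm q k i
  have hkj := F_comm q k j
  rcases hthree a with rfl | rfl | rfl <;> rcases hthree b with rfl | rfl | rfl <;>
    simp only [if_true, F_self, hji, hki, hkj, hij, hjk, hik,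
      hij.symm, hjk.symm, hik.symm, if_false, hi] <;>
    linarith

/-- A weak solution is harmonic on each cell all of whose points, except for the three boundary
points, lie in `Ω`, if it is continuous on the cell. -/
lemma HasLaplacianOn.isHarmonic (hq : AffineIndependent ℝ q) {W : Plane → ℝ}
    (hW : HasLaplacianOn q (Omega q) W 0) {w : List (Fin 3)}
    (hΩ : ∀ y ∈ gasket q, (∀ l, y ≠ q l) → cellMap q w y ∈ Omega q)
    (hc : ContinuousOn (W ∘ cellMap q w) (gasket q)) : IsHarmonic q (W ∘ cellMap q w) := by
  have hsub : ∀ (v : List (Fin 3)) (a b : Fin 3), a ∈ v → b ∈ v → a ≠ b →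
      cell q (w ++ v) ⊆ Omega q := by
    rintro v a b ha hb hab _ ⟨y, hy, rfl⟩
    rw [cellMap_append]
    refine hΩ _ (cellMap_mem_gasket hy v) fun l h => hab ?_
    have h1 := eq_of_mem_of_cellMap_eq_vertex hq hy h
    rw [h1 a ha, h1 b hb]
  have hcell : ∀ v : List (Fin 3), W ∘ cellMap q (w ++ v) = (W ∘ cellMap q w) ∘ cellMap q v := by
    intro v
    funext x
    simp only [Function.comp_apply, cellMap_append]
  have hcorner : ∀ (i : Fin 3) (n : ℕ),
      MidpointRule q (W ∘ cellMap q ((w ++ [i]) ++ List.replicate n i)) := by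
    intro i n
    refine hW.midpointRule_corner hq (fun y hy hyi => ?_) ?_ n
    · rw [cellMap_append]
      refine hΩ _ (F_mem_gasket hy i) fun l h => ?_
      obtain ⟨rfl, h2⟩ := F_eq_vertex hq hy h
      exact hyi h2
    · rw [hcell]
      exact hc.comp (continuous_F q i).continuousOn fun _ hx => F_mem_gasket hx i
  intro v
  cases v with
  | nil =>
    refine midpointRule_of_flux fun i j hij => ?_
    have h := hW.flux_add_flux hq w hij 1 (hsub _ i j (by simp) (by simp) hij)
      (hsub _ i j (by simp) (by simp) hij)
    have hf : ∀ i j, flux q (W ∘ cellMap q (w ++ i :: List.replicate 1 j)) j =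
        3 / 5 * flux q ((W ∘ cellMap q w) ∘ F q i) j := by
      intro i j
      have h0 := hcorner i 0
      rw [List.replicate_zero, List.append_nil, hcell] at h0
      rw [hcell]
      exact h0.flux_comp_F j
    rw [hf, hf, ← mul_add] at h
    exact (mul_eq_zero.1 h).resolve_left (by norm_num)
  | cons i v =>
    rw [← hcell]
    by_cases hv : ∃ a ∈ v, a ≠ i
    · obtain ⟨a, ha, hai⟩ := hv
      exact hW.midpointRule hq (hsub _ a i (by simp [ha]) (by simp) hai)
    · push Not at hv
      have := hcorner i v.length
      rwa [List.append_assoc, ← List.eq_replicate_of_mem hv] at this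

/-! ### Uniqueness -/

/-- The matching of normal derivatives at `y_{m+1}` for a solution of the boundary value problem. -/
lemma SolvesBVP.recurrence (hq : AffineIndependent ℝ q) {a : ℕ → ℝ} {W : Plane → ℝ}
    (hW : SolvesBVP q a W) (hh : ∀ m, IsHarmonic q (W ∘ cellMap q (strip m))) (m : ℕ) :
    16 * W (yPt q (m + 1)) = 3 * W (yPt q m) + 5 * W (yPt q (m + 2)) +
      3 * a (m + 1) + 5 * a (m + 2) := by
  have e1 : List.replicate m (0 : Fin 3) ++ 0 :: List.replicate 2 1 = strip (m + 1) ++ [1] := by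
    rw [strip, List.replicate_succ' (n := m), List.append_assoc, List.append_assoc]; rfl
  have e2 : List.replicate m (0 : Fin 3) ++ 1 :: List.replicate 2 0 = strip m ++ [0, 0] := by
    simp [strip]
  have h1 : cell q (strip (m + 1) ++ [1]) ⊆ Omega q := by
    rintro _ ⟨y, hy, rfl⟩
    rw [cellMap_append]
    refine cellMap_strip_mem_Omega hq (F_mem_gasket hy 1) (fun h => ?_) fun h => ?_
    · exact absurd (F_eq_vertex hq hy h).1 (by decide)
    · exact absurd (eq_of_mem_of_cellMap_eq_vertex hq (F_mem_gasket hy 1) h 0 (by simp [strip]))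
        (by decide)
  have h2 : cell q (strip m ++ [0, 0]) ⊆ Omega q := by
    rintro _ ⟨y, hy, rfl⟩
    rw [cellMap_append]
    have hy' := F_mem_gasket hy 0
    refine cellMap_strip_mem_Omega hq (F_mem_gasket hy' 0) (fun h => ?_) fun h => ?_
    · exact absurd (F_eq_vertex hq hy' h).1 (by decide)
    · exact absurd (F_eq_vertex hq hy' (cellMap_strip_eq_vertex hq (F_mem_gasket hy' 0) h).2).1
        (by decide)
  -- With `k = 1` one of the two cells would be `F_0^(m+1) F_1 SG`, whose corner `x_{m+2}` is not in
  -- `Ω`; hence `k = 2`.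
  have h := hW.laplacian.flux_add_flux hq (List.replicate m 0) (i := 0) (j := 1) (by decide) 2
    (e1 ▸ h1) (e2 ▸ h2)
  rw [e1, e2] at h
  have f1 : W ∘ cellMap q (strip (m + 1) ++ [1]) = (W ∘ cellMap q (strip (m + 1))) ∘ F q 1 := by
    funext x
    simp only [Function.comp_apply, cellMap_append]
    rfl
  have f2 : W ∘ cellMap q (strip m ++ [0, 0]) = ((W ∘ cellMap q (strip m)) ∘ F q 0) ∘ F q 0 := by
    funext x
    simp only [Function.comp_apply, cellMap_append]
    rfl
  rw [f1, f2, (hh (m + 1)).midpointRule.flux_comp_F,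
    ((hh m).comp_F 0).midpointRule.flux_comp_F, (hh m).midpointRule.flux_comp_F,
    flux_eq _ (i := 1) (j := 0) (k := 2) (by decide) (by decide) (by decide),
    flux_eq _ (i := 0) (j := 1) (k := 2) (by decide) (by decide) (by decide)] at h
  simp only [Function.comp_apply, cellMap_strip_zero, cellMap_strip_one, cellMap_strip_two,
    hW.value_x _ (Nat.succ_pos _)] at h
  linarith

/-- The values of a continuous solution at the points `y_m` satisfy the recurrence and are bounded,
hence they are the values `b m`; harmonicity on the cells `F_0^m F_1 SG` does the rest. -/
lemma SolvesBVP.eqOn (hq : AffineIndependent ℝ q) {a b : ℕ → ℝ} {A : ℝ}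
    (ha : Tendsto a atTop (𝓝 A)) (hb : Tendsto b atTop (𝓝 A)) (hb0 : b 0 = a 0)
    (hrec : ∀ m, 16 * b (m + 1) = 3 * b m + 5 * b (m + 2) + 3 * a (m + 1) + 5 * a (m + 2))
    {u W : Plane → ℝ} (hu : IsHarmonicExtension q a b u) (hu0 : u (q 0) = A)
    (hWc : ContinuousOn W (closureOmega q)) (hW : SolvesBVP q a W) :
    EqOn W u (closureOmega q) := by
  have hc : ∀ m, ContinuousOn (W ∘ cellMap q (strip m)) (gasket q) := fun m =>
    (hWc.mono (cell_strip_subset_closureOmega hq m)).comp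
      (continuous_cellMap q _).continuousOn (mapsTo_image _ _)
  have hh : ∀ m, IsHarmonic q (W ∘ cellMap q (strip m)) := fun m =>
    hW.laplacian.isHarmonic hq (fun y hy hyl => cellMap_strip_mem_Omega hq hy (hyl 2)
      fun h => hyl 1 (cellMap_strip_eq_vertex hq hy h).2) (hc m)
  have hmem0 : q 0 ∈ closureOmega q := Or.inr (Or.inl (Or.inl rfl))
  have hymem : ∀ m, yPt q m ∈ closureOmega q := fun m =>
    cell_strip_subset_closureOmega hq m ⟨q 1, vertex_mem_gasket q 1, cellMap_strip_one q m⟩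
  have hxmem : ∀ m, xPt q (m + 1) ∈ closureOmega q := fun m =>
    cell_strip_subset_closureOmega hq m ⟨q 2, vertex_mem_gasket q 2, cellMap_strip_two q m⟩
  have hylim : Tendsto (fun m => W (yPt q m)) atTop (𝓝 (W (q 0))) :=
    (hWc _ hmem0).tendsto.comp (tendsto_nhdsWithin_iff.2
      ⟨tendsto_iterate_F q 0 (q 1), Eventually.of_forall hymem⟩)
  have hxlim : Tendsto (fun m => W (xPt q (m + 1))) atTop (𝓝 (W (q 0))) :=
    (hWc _ hmem0).tendsto.comp (tendsto_nhdsWithin_iff.2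
      ⟨tendsto_iterate_F q 0 (F q 2 (q 1)), Eventually.of_forall hxmem⟩)
  have hW0 : W (q 0) = A := tendsto_nhds_unique hxlim
    (((tendsto_add_atTop_iff_nat 1).2 ha).congr fun m => (hW.value_x _ (Nat.succ_pos m)).symm)
  obtain ⟨C, hC⟩ := abs_le_of_tendsto (hylim.sub hb)
  have hy : ∀ m, W (yPt q m) = b m := by
    intro m
    refine sub_eq_zero.1 (eq_zero_of_bounded_recurrence hC ?_ (fun n => ?_) m)
    · exact sub_eq_zero.2 (hW.value_q.trans hb0.symm)
    · linarith [hW.recurrence hq hh n, hrec n]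
  intro x hx
  rw [closureOmega_eq hq] at hx
  rcases hx with rfl | hx
  · rw [hW0, hu0]
  · obtain ⟨m, y, hyg, rfl⟩ := mem_iUnion.1 hx
    obtain ⟨huc, huh⟩ := hu.strip_isHarmonic m
    refine (hh m).eqOn (hc m) huh huc (fun i => ?_) hyg
    fin_cases i
    · simp only [Function.comp_apply, Fin.zero_eta, cellMap_strip_zero, hy, hu.value_y]
    · simp only [Function.comp_apply, Fin.mk_one, cellMap_strip_one, hy, hu.value_y]
    · simp only [Function.comp_apply, Fin.reduceFinMk, cellMap_strip_two,
        hW.value_x _ (Nat.succ_pos m), hu.value_x _ (Nat.succ_pos m)]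

end HalfGasket

theorem corollary2p5
    (T : Affine.Triangle ℝ HalfGasket.Plane) (hT : T.Equilateral)
    (a : ℕ → ℝ) (A : ℝ) (ha : Tendsto a atTop (𝓝 A))
    (b : ℕ → ℝ) (hb0 : b 0 = a 0)
    (hb1 : b 1 = 1 / 5 * (a 0 + a 1 + 18 * ∑' k : ℕ, (1 / 3 : ℝ) ^ (k + 2) * a (k + 2)))
    (hb : ∀ m : ℕ, 2 ≤ m →
      b m = (1 / 5 : ℝ) ^ m * (a 0 - 9 / 7 * ∑' k : ℕ, (1 / 3 : ℝ) ^ (k + 1) * a (k + 1)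
          + 2 / 7 * ∑ k ∈ Finset.Icc 1 m, (5 : ℝ) ^ k * a k)
        + 9 / 7 * ∑' k : ℕ, (1 / 3 : ℝ) ^ (k + 1) * a (m + (k + 1))) :
    (Summable fun k : ℕ => (1 / 3 : ℝ) ^ k * a k) ∧
    (∃ u : HalfGasket.Plane → ℝ,
      HalfGasket.IsHarmonicExtension T.points a b u ∧ u (T.points 0) = A) ∧
    ∀ u : HalfGasket.Plane → ℝ,
      HalfGasket.IsHarmonicExtension T.points a b u → u (T.points 0) = A →
        ContinuousOn u (HalfGasket.closureOmega T.points) ∧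
        HalfGasket.SolvesBVP T.points a u ∧
        ∀ w : HalfGasket.Plane → ℝ,
          ContinuousOn w (HalfGasket.closureOmega T.points) →
          HalfGasket.SolvesBVP T.points a w →
          EqOn w u (HalfGasket.closureOmega T.points) := by
  have hq : AffineIndependent ℝ T.points := T.independent
  obtain ⟨C, hC⟩ := HalfGasket.abs_le_of_tendsto ha
  -- The formula for `m ≥ 2` is also valid for `m = 0` and `m = 1`.
  obtain rfl : b = HalfGasket.vertexValue a := by
    funext m
    match m with
    | 0 => rw [hb0, HalfGasket.vertexValue_zero]
    | 1 => rw [hb1, HalfGasket.vertexValue_one hC]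
    | m + 2 =>
      rw [hb _ (by omega), HalfGasket.vertexValue, HalfGasket.tailAverage,
        HalfGasket.tailAverage]
      simp only [zero_add]
  have hblim := HalfGasket.tendsto_vertexValue ha
  have hrec := HalfGasket.vertexValue_recurrence hC
  refine ⟨HalfGasket.summable_geometric_mul hC,
    HalfGasket.exists_isHarmonicExtension hq a _ A, fun u hu hu0 => ?_⟩
  have huc := hu.continuousOn hq ha hblim hu0
  exact ⟨huc, hu.solvesBVP hb0 hrec huc, fun w hwc hw =>
    hw.eqOn hq ha hblim hb0 hrec hu hu0 hwc⟩
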